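/- **Setting.** Let $d_L\ge 1$, $M\ge 4$, $d\ge 2$, and let $\mathcal G=(V,E)$ be the regular $d_L$-dimensional lattice of linear size $M$, with $N=M^{d_L}$ sites and nearest-neighbour edges, with open or periodic boundary conditions; $z=2d_L$ is its coordination number and $\delta$ its graph distance. A qudit $\mathbb C^d$ sits at every site, $\mathcal H=(\mathbb C^d)^{\otimes N}$. For $A\subseteq V$ let $a=\{n\notin A:\delta(n,A)\le 1\}$, $\bar A=A\cup a$, $b=\{n\notin \bar A:\delta(n,A)\le 2\}$, $B=V\setminus(\bar A\cup b)$, $\bar B=B\cup b=V\setminus\bar A$, and let $S$ be the collection of all $A$ with $B\ne\emptyset$. $X_C$ denotes an operator supported on $C$, ${\rm tr}_C$ the partial trace over $C$, and $\mathcal E^\dagger$ the Hilbert–Schmidt adjoint of a channel (completely positive trace-preserving map) $\mathcal E$ on $L(\mathcal H)$. * $\mathcal E$ is in **CPQC** if for all $A\in S$ and $X_A$ the operator $\mathcal E^\dagger(X_A)$ is supported on $\bar A$. * $\mathcal E$ is in **LPQC** if for all $A\in S$ and all $\rho_{\bar A},\rho_{\bar B}\ge 0$: ${\rm tr}_{a,b}[\mathcal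 E(\rho_{\bar A}\rho_{\bar B})]=d^{-N}\,{\rm tr}_{a,\bar B}[\mathcal E(\rho_{\bar A})]\;{\rm tr}_{\bar A,b}[\mathcal E(\rho_{\bar B})]$. * **fQC** is the set of CPQC with $\mathcal E^\dagger(X_AY_B)=\mathcal E^\dagger(X_A)\,\mathcal E^\dagger(Y_B)$ for all $A\in S$, $X_A$, $Y_B$. * **dQC** is the set of CPQC of the form $\mathcal E(\rho)={\rm tr}_{V'}\big[U(\rho\otimes(|1\rangle\langle 1|)^{\otimes N})U^\dagger\big]$, where $V'$ is a copy of the lattice carrying one ancilla qudit $\mathbb C^d$ per site, and $U$ is a unitary on $\mathcal H\otimes\mathcal H$ such that $X\mapsto UXU^\dagger$ is a CPQC (i.e. a QCA) on the graph made of the two copies of $\mathcal G$ with an additional edge between each site and its ancilla. * For a function $f$ of $(d,d_L,z)$, **tnQC**$_f$ is the set of CPQC whose Choi state $R=\sum_{s,t}\mathcal E(|s\rangle\langle t|)\otimes|s\rangle\langle t|$ is a PEPO on $\mathcal G$ (one tensor per site, carrying the indices of the qudit and of its ancilla, and one auxiliary index for each edge at that site) of bond dimension at most $f(d,d_L,z)$;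 this bound does not depend on $M$. **Theorem.** 1. For every such lattice, $dQC\subsetneq fQC=LPQC\subseteq CPQC$, and the last inclusion is strict except for the periodic chains ($d_L=1$) with $M\in\{4,5\}$, on which $S=\{\emptyset\}$. 2. There is a function $f_0$ of $(d,d_L,z)$ such that for every $f\ge f_0$ and every such lattice $dQC\subsetneq tnQC_f$ and, except for the same periodic chains, $tnQC_f\not\subseteq LPQC$. 3. Conversely, for every $f$, every $d$, $d_L$ and either boundary condition, $LPQC\not\subseteq tnQC_f$ for all sufficiently large $M$. More precisely, for every $d$, $d_L$ and either boundary condition there is a constant $c>1$ such that for every $M\ge 4$ there is an LPQC such that every PEPO for its Choi state has bond dimension at least $c^M$. -/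

import Mathlib

open scoped ComplexOrder

namespace QuditLattice

/-! ### Lattices and regions -/

/-- Boundary conditions of the lattice. -/
inductive Boundary where
  | opn
  | periodic

/-- The one-dimensional lattice with `M` sites: a path or a cycle. -/
def line (bc : Boundary) (M : ℕ) : SimpleGraph (Fin M) :=
  match bc with
  | .opn => SimpleGraph.pathGraph M
  | .periodic => SimpleGraph.cycleGraph M

/-- The sites of the `dL`-dimensional lattice of linear size `M`. -/
abbrev Site (dL M : ℕ) : Type := Fin dL → Fin M

/-- The regular `dL`-dimensional lattice: two sites are joined by an edge iff they differ in exactly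
one coordinate, and there by one step of the path (open boundary conditions) or of the cycle
(periodic boundary conditions). -/
def lattice (bc : Boundary) (dL M : ℕ) : SimpleGraph (Site dL M) where
  Adj n m := ∃ i, (line bc M).Adj (n i) (m i) ∧ ∀ j, j ≠ i → n j = m j
  symm := ⟨fun _ _ ⟨i, h, h'⟩ => ⟨i, h.symm, fun j hj => (h' j hj).symm⟩⟩
  loopless := ⟨fun _ ⟨_, h, _⟩ => h.ne rfl⟩

section Regions

variable {V : Type*} [Fintype V] [DecidableEq V] (G : SimpleGraph V)

open Classical in
/-- The `r`-neighbourhood `a_r = {n ∉ A : δ(n, A) ≤ r}` of `A`. -/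
noncomputable def collar (r : ℕ) (A : Finset V) : Finset V :=
  {n | n ∉ A ∧ ∃ m ∈ A, G.edist n m ≤ r}

/-- `Ā = A ∪ a`, for range `r = 1`. -/
noncomputable def regAbar (A : Finset V) : Finset V := A ∪ collar G 1 A

/-- `b = a_2 \ a_1`, the next-nearest neighbourhood for range `r = 1`. -/
noncomputable def regb (A : Finset V) : Finset V := collar G 2 A \ collar G 1 A

/-- `B = V \ (Ā ∪ b)`. -/
noncomputable def regB (A : Finset V) : Finset V := (regAbar G A ∪ regb G A)ᶜ

/-- `B̄ = B ∪ b`. -/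
noncomputable def regBbar (A : Finset V) : Finset V := regB G A ∪ regb G A

/-- The collection `S` of all regions `A` for which `B` is not empty. -/
def regS : Set (Finset V) := {A | (regB G A).Nonempty}

end Regions

/-! ### Operators and channels -/

/-- Operators on the Hilbert space of qudits of dimension `d` placed at the points of `W`,
as matrices in the computational basis. -/
abbrev Op (W : Type*) (d : ℕ) : Type _ := Matrix (W → Fin d) (W → Fin d) ℂ

section Operators

variable {V : Type*} [Fintype V] [DecidableEq V] {d : ℕ}

/-- `X_C ⊗ 1`: an operator on the qudits of the region `C`, as an operator on all qudits. -/
noncomputable def embed (C : Finset V) (X : Op C d) : Op V d :=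
  Matrix.of fun s t =>
    if ∀ v, v ∉ C → s v = t v then X (fun v => s v) (fun v => t v) else 0

/-- The basis label that agrees with `s` on `K` and with `u` off `K`. -/
def glue {K : Finset V} (s : K → Fin d) (u : {v // v ∉ K} → Fin d) : V → Fin d :=
  fun v => if h : v ∈ K then s ⟨v, h⟩ else u ⟨v, h⟩

/-- The partial trace over all the qudits outside `K`. -/
noncomputable def reduce (K : Finset V) (X : Op V d) : Op K d :=
  Matrix.of fun s t => ∑ u : {v // v ∉ K} → Fin d, X (glue s u) (glue t u)

/-- The tensor product of operators on two disjoint regions `A` and `B`, as an operator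
on `A ∪ B`. -/
def tensor (A B : Finset V) (X : Op A d) (Y : Op B d) : Op (A ∪ B : Finset V) d :=
  Matrix.of fun s t =>
    X (fun v => s ⟨v, Finset.mem_union_left B v.2⟩) (fun v => t ⟨v, Finset.mem_union_left B v.2⟩) *
    Y (fun v => s ⟨v, Finset.mem_union_right A v.2⟩) (fun v => t ⟨v, Finset.mem_union_right A v.2⟩)

/-- `id_k ⊗ E`, acting on `k × k` block matrices. -/
def ampliation (k : ℕ) (E : Op V d →ₗ[ℂ] Op V d)
    (X : Matrix (Fin k × (V → Fin d)) (Fin k × (V → Fin d)) ℂ) :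
    Matrix (Fin k × (V → Fin d)) (Fin k × (V → Fin d)) ℂ :=
  Matrix.of fun p q => E (Matrix.of fun s t => X (p.1, s) (q.1, t)) p.2 q.2

/-- Quantum channels: completely positive trace-preserving linear maps. -/
structure IsChannel (E : Op V d →ₗ[ℂ] Op V d) : Prop where
  trace_eq : ∀ X, (E X).trace = X.trace
  completelyPositive : ∀ (k : ℕ) (X : Matrix (Fin k × (V → Fin d)) (Fin k × (V → Fin d)) ℂ),
    X.PosSemidef → (ampliation k E X).PosSemidef

/-- The adjoint `E†` of `E` for the Hilbert-Schmidt inner product `⟨X, Y⟩ = tr (Xᴴ Y)`. -/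
noncomputable def adj (E : Op V d →ₗ[ℂ] Op V d) (X : Op V d) : Op V d :=
  Matrix.of fun s t => star (Matrix.trace (X.conjTranspose * E (Matrix.single s t 1)))

/-- `adj E` is the Hilbert-Schmidt adjoint of `E`. -/
theorem trace_adj (E : Op V d →ₗ[ℂ] Op V d) (X Y : Op V d) :
    ((adj E X).conjTranspose * Y).trace = (X.conjTranspose * E Y).trace := by
  conv_rhs => rw [Matrix.matrix_eq_sum_single Y]
  simp only [map_sum, Matrix.mul_sum, Matrix.trace_sum]
  rw [Finset.sum_comm]
  simp only [Matrix.trace, Matrix.diag_apply, Matrix.mul_apply, Matrix.conjTranspose_apply]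
  refine Finset.sum_congr rfl fun t _ => Finset.sum_congr rfl fun s _ => ?_
  have h : Matrix.single s t (Y s t) = Y s t • Matrix.single s t (1 : ℂ) := by
    simp [Matrix.smul_single]
  rw [h, map_smul]
  simp only [adj, Matrix.of_apply, star_star, Matrix.trace, Matrix.diag_apply, Matrix.mul_apply,
    Matrix.conjTranspose_apply, Matrix.smul_apply, smul_eq_mul, Finset.sum_mul]
  refine Finset.sum_congr rfl fun _ _ => Finset.sum_congr rfl fun _ _ => by ring

/-- The Choi-Jamiolkowski state `R = (E ⊗ id)(Φ)`, `Φ = ∑ |s'⟩⟨t'| ⊗ |s'⟩⟨t'|`; the first component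
of an index is the label of the system, the second one that of the ancillas. -/
def choi (E : Op V d →ₗ[ℂ] Op V d) :
    Matrix ((V → Fin d) × (V → Fin d)) ((V → Fin d) × (V → Fin d)) ℂ :=
  Matrix.of fun p q => E (Matrix.single p.2 q.2 1) p.1 q.1

open Classical in
/-- `R`, an operator on the qudits and their ancillas, is a PEPO of bond dimension `D` on the graph
`G`: at each vertex there is a tensor that carries the row and column labels of the qudit and of its
ancilla, and one auxiliary index with `D` values for each edge at that vertex; the entries of `R`
are obtained by contracting the auxiliary indices along the edges. -/
def IsPEPO (G : SimpleGraph V) (D : ℕ)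
    (R : Matrix ((V → Fin d) × (V → Fin d)) ((V → Fin d) × (V → Fin d)) ℂ) : Prop :=
  ∃ T : (v : V) → (G.incidenceSet v → Fin D) → Matrix (Fin d × Fin d) (Fin d × Fin d) ℂ,
    ∀ p q, R p q = ∑ e : G.edgeSet → Fin D, ∏ v,
      T v (fun x => e ⟨x, G.incidenceSet_subset v x.2⟩) (p.1 v, p.2 v) (q.1 v, q.2 v)

/-! ### Classes of channels -/

/-- Causality preserving quantum channels: `E†(X_A)` is supported on `Ā`. -/
def CPQC (G : SimpleGraph V) (d : ℕ) : Set (Op V d →ₗ[ℂ] Op V d) :=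
  {E | IsChannel E ∧ ∀ A ∈ regS G, ∀ X : Op A d, ∃ Y : Op (regAbar G A) d,
    adj E (embed A X) = embed (regAbar G A) Y}

/-- Locality preserving quantum channels: for all positive `ρ` on `Ā` and `τ` on `B̄`,
`tr_{a,b}[E(ρ τ)] = d^{-N} tr_{a,B̄}[E(ρ)] tr_{Ā,b}[E(τ)]`. -/
def LPQC (G : SimpleGraph V) (d : ℕ) : Set (Op V d →ₗ[ℂ] Op V d) :=
  {E | IsChannel E ∧ ∀ A ∈ regS G, ∀ (ρ : Op (regAbar G A) d) (τ : Op (regBbar G A) d),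
    ρ.PosSemidef → τ.PosSemidef →
    reduce (A ∪ regB G A) (E (embed (regAbar G A) ρ * embed (regBbar G A) τ)) =
      (1 / (d : ℂ) ^ Fintype.card V) •
        tensor A (regB G A) (reduce A (E (embed (regAbar G A) ρ)))
          (reduce (regB G A) (E (embed (regBbar G A) τ)))}

/-- Causality preserving channels with `E†(X_A Y_B) = E†(X_A) E†(Y_B)`. -/
def fQC (G : SimpleGraph V) (d : ℕ) : Set (Op V d →ₗ[ℂ] Op V d) :=
  {E | E ∈ CPQC G d ∧ ∀ A ∈ regS G, ∀ (X : Op A d) (Y : Op (regB G A) d),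
    adj E (embed A X * embed (regB G A) Y) = adj E (embed A X) * adj E (embed (regB G A) Y)}

/-- Causality preserving channels whose Choi-Jamiolkowski state is a PEPO with bond dimension at
most `D₀`. -/
def tnQC (G : SimpleGraph V) (d D₀ : ℕ) : Set (Op V d →ₗ[ℂ] Op V d) :=
  {E | E ∈ CPQC G d ∧ ∃ D ≤ D₀, IsPEPO G D (choi E)}

/-- The unitary channel `X ↦ U X U†`. -/
def conjBy (U : Op V d) : Op V d →ₗ[ℂ] Op V d :=
  LinearMap.mulRight ℂ U.conjTranspose ∘ₗ LinearMap.mulLeft ℂ U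

/-- `U` defines a quantum cellular automaton: a unitary causality preserving channel. -/
def IsQCA (G : SimpleGraph V) (U : Op V d) : Prop :=
  U ∈ Matrix.unitaryGroup (V → Fin d) ℂ ∧ conjBy U ∈ CPQC G d

/-- The lattice of the qudits `(v, false)` and the ancillas `(v, true)`: two copies of `G`, with an
edge between each qudit and its ancilla. -/
def doubled (G : SimpleGraph V) : SimpleGraph (V × Bool) := G.boxProd ⊤

/-- `ρ ⊗ (|1⟩⟨1|)^{⊗ N}`, all ancillas being in the first vector of the computational basis. -/
def withAncillas (ρ : Op V d) : Op (V × Bool) d :=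
  Matrix.of fun s t =>
    if ∀ v, (s (v, true)).val = 0 ∧ (t (v, true)).val = 0 then
      ρ (fun v => s (v, false)) (fun v => t (v, false))
    else 0

/-- The partial trace over the ancillas. -/
def traceAncillas (X : Op (V × Bool) d) : Op V d :=
  Matrix.of fun s t => ∑ u : V → Fin d,
    X (fun p => if p.2 then u p.1 else s p.1) (fun p => if p.2 then u p.1 else t p.1)

/-- Causality preserving channels with a Stinespring dilation by a quantum cellular automaton `U`
on qudits and ancillas: `E(ρ) = tr_{V'}[U (ρ ⊗ (|1⟩⟨1|)^{⊗ N}) U†]`. -/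
def dQC (G : SimpleGraph V) (d : ℕ) : Set (Op V d →ₗ[ℂ] Op V d) :=
  {E | E ∈ CPQC G d ∧ ∃ U : Op (V × Bool) d, IsQCA (doubled G) U ∧
    ∀ ρ, E ρ = traceAncillas (conjBy U (withAncillas ρ))}

end Operators

end QuditLattice

open QuditLattice

/-! Everything is expressed through the Heisenberg picture: `dual E` is the adjoint of `E` for the
pairing tr(XY), and supports are tracked by the spaces `localOps d C`, each spanned by product
operators.

The equality fQC = LPQC rests on one fact: the normalized trace factorizes over disjoint regions
(`trace_mul_of_disjoint`), and, conversely, an operator whose correlations are trivial outside `C`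
is supported on `C` (`mem_localOps_of_trace_eq`). Multiplicativity of `dual E` on distant operators
is then the same as factorization of the output correlations.

For dQC the dual map is conjugation by `U`, followed by the expectation `compress` in the product
state of the ancillas. In the doubled lattice the evolved observable of a site touches no ancilla
but that site's own, because the edge to the ancilla uses up the whole range. So distinct sites
never share an ancilla, and `compress` is multiplicative on products over distinct sites, even
neighbouring ones. This gives dQC ⊆ fQC. It also writes the Choi state as an ordered product of
operators on closed neighbourhoods, which is a PEPO: each edge carries one matrix unit from each of
its two ends, hence bond dimension `d ^ 4`.

All separations come from channels `prep σ` that forget the input and prepare `σ`; they are always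
causal, and lie in fQC exactly when correlations of `σ` between `A` and `B` factorize. The maximally
mixed state gives a Choi state of full rank, while a dilation allows rank at most `d ^ N`. A mixture
of two constant basis states has a PEPO of bond dimension 2 but long-range correlations. Finally,
the maximally mixed state plus a small Hermitian term that is traceless at every site is invisible
on every proper subset of sites, hence in fQC; the term can be chosen with rank exponential in the
volume across a cut through the lattice, whereas a PEPO only allows rank exponential in the area of
the cut. -/

namespace QuditLattice

set_option linter.unusedSectionVars false

/-! ### Product operators, supports and traces -/

section LocalOperators

variable {V : Type*} [Fintype V] [DecidableEq V] {d : ℕ}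

/-- The tensor product of one-site operators. -/
def prodOp (M : V → Matrix (Fin d) (Fin d) ℂ) : Op V d :=
  Matrix.of fun s t => ∏ v, M v (s v) (t v)

theorem prodOp_apply (M : V → Matrix (Fin d) (Fin d) ℂ) (s t : V → Fin d) :
    prodOp M s t = ∏ v, M v (s v) (t v) := rfl

theorem prodOp_mul (M N : V → Matrix (Fin d) (Fin d) ℂ) :
    prodOp M * prodOp N = prodOp fun v => M v * N v := by
  ext s t
  simp only [prodOp_apply, Matrix.mul_apply, ← Finset.prod_mul_distrib]
  rw [Finset.prod_univ_sum, Fintype.piFinset_univ]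

theorem prodOp_one : prodOp (fun _ : V => (1 : Matrix (Fin d) (Fin d) ℂ)) = 1 := by
  ext s t
  simp only [prodOp_apply, Matrix.one_apply, Finset.prod_ite_zero, Finset.prod_const_one,
    Finset.mem_univ, true_implies, funext_iff]

theorem trace_prodOp (M : V → Matrix (Fin d) (Fin d) ℂ) :
    (prodOp M).trace = ∏ v, (M v).trace := by
  simp only [Matrix.trace, Matrix.diag_apply, prodOp_apply]
  rw [Finset.prod_univ_sum, Fintype.piFinset_univ]

theorem conjTranspose_prodOp (M : V → Matrix (Fin d) (Fin d) ℂ) :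
    (prodOp M).conjTranspose = prodOp fun v => (M v).conjTranspose := by
  ext s t
  simp [prodOp_apply, Matrix.conjTranspose_apply]

theorem single_eq_prodOp (a b : V → Fin d) :
    Matrix.single a b (1 : ℂ) = prodOp fun v => Matrix.single (a v) (b v) (1 : ℂ) := by
  ext s t
  simp only [prodOp_apply, Matrix.single_apply, Finset.prod_ite_zero, Finset.prod_const_one,
    Finset.mem_univ, true_implies, funext_iff, forall_and]

/-- Extension of a family of one-site operators by identities. -/
def extendOne (C : Finset V) (M : C → Matrix (Fin d) (Fin d) ℂ) (v : V) :
    Matrix (Fin d) (Fin d) ℂ :=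
  if h : v ∈ C then M ⟨v, h⟩ else 1

theorem embed_prodOp (C : Finset V) (M : C → Matrix (Fin d) (Fin d) ℂ) :
    embed C (prodOp M) = prodOp (extendOne C M) := by
  ext s t
  simp only [embed, Matrix.of_apply, prodOp_apply]
  rw [← Finset.prod_mul_prod_compl C (fun v => extendOne C M v (s v) (t v)),
    ← Finset.prod_coe_sort C (fun v => extendOne C M v (s v) (t v))]
  have h1 : ∀ v : C, extendOne C M v = M v := fun v => by simp [extendOne]
  have h2 : ∏ v ∈ Cᶜ, extendOne C M v (s v) (t v) =
      if ∀ v, v ∉ C → s v = t v then 1 else 0 := by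
    rw [Finset.prod_congr rfl (g := fun v => if s v = t v then (1 : ℂ) else 0)]
    · simp [Finset.prod_ite_zero]
    · intro v hv
      simp [extendOne, Finset.mem_compl.1 hv, Matrix.one_apply]
  simp only [h1, h2]
  split_ifs <;> simp

/-- `embed` as a linear map. -/
noncomputable def embedLin (C : Finset V) : Op C d →ₗ[ℂ] Op V d where
  toFun := embed C
  map_add' X Y := by
    ext s t
    simp only [embed, Matrix.of_apply, Matrix.add_apply]
    split_ifs <;> simp
  map_smul' c X := by
    ext s t
    simp [embed]

theorem embedLin_apply (C : Finset V) (X : Op C d) : embedLin C X = embed C X := rfl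

/-- The operators supported on `C`. -/
noncomputable def localOps (d : ℕ) (C : Finset V) : Submodule ℂ (Op V d) :=
  LinearMap.range (embedLin C)

theorem mem_localOps {C : Finset V} {X : Op V d} :
    X ∈ localOps d C ↔ ∃ Y : Op C d, X = embed C Y := by
  simp [localOps, embedLin_apply, eq_comm]

theorem embed_mem (C : Finset V) (X : Op C d) : embed C X ∈ localOps d C :=
  mem_localOps.2 ⟨X, rfl⟩

theorem prodOp_mem {C : Finset V} {M : V → Matrix (Fin d) (Fin d) ℂ}
    (h : ∀ v, v ∉ C → M v = 1) : prodOp M ∈ localOps d C := by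
  refine mem_localOps.2 ⟨prodOp fun v => M v, ?_⟩
  rw [embed_prodOp]
  congr 1
  ext1 v
  by_cases hv : v ∈ C
  · simp [extendOne, hv]
  · simp [extendOne, hv, h v hv]

/-- Matrix units are products of one-site matrix units. Through this span, any multilinear claim
about supported operators need only be checked on product operators, site by site. -/
theorem localOps_eq_span (C : Finset V) :
    localOps d C = Submodule.span ℂ {X | ∃ M : V → Matrix (Fin d) (Fin d) ℂ,
      (∀ v, v ∉ C → M v = 1) ∧ X = prodOp M} := by
  apply le_antisymm
  · rintro _ ⟨Y, rfl⟩
    rw [Matrix.matrix_eq_sum_single Y]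
    simp only [map_sum]
    refine Submodule.sum_mem _ fun a _ => Submodule.sum_mem _ fun b _ => ?_
    have h : Matrix.single a b (Y a b) = Y a b • Matrix.single a b (1 : ℂ) := by
      simp [Matrix.smul_single]
    rw [h, map_smul]
    refine Submodule.smul_mem _ _ (Submodule.subset_span
      ⟨extendOne C fun v => Matrix.single (a v) (b v) 1, fun v hv => by simp [extendOne, hv], ?_⟩)
    rw [embedLin_apply, single_eq_prodOp, embed_prodOp]
  · refine Submodule.span_le.2 ?_
    rintro _ ⟨M, hM, rfl⟩
    exact prodOp_mem hM

theorem localOps_induction {C : Finset V} {p : (X : Op V d) → X ∈ localOps d C → Prop}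
    (prod : ∀ (M : V → Matrix (Fin d) (Fin d) ℂ) (hM : ∀ v, v ∉ C → M v = 1),
      p (prodOp M) (prodOp_mem hM))
    (add : ∀ X Y hX hY, p X hX → p Y hY → p (X + Y) (add_mem hX hY))
    (smul : ∀ (c : ℂ) X hX, p X hX → p (c • X) (Submodule.smul_mem _ c hX))
    {X : Op V d} (hX : X ∈ localOps d C) : p X hX := by
  have hX' := hX
  rw [localOps_eq_span] at hX'
  suffices h : ∃ h : X ∈ localOps d C, p X h from h.2
  clear hX
  induction hX' using Submodule.span_induction with
  | mem x h => obtain ⟨M, hM, rfl⟩ := h; exact ⟨_, prod M hM⟩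
  | zero =>
    have := smul 0 _ _ (prod (fun _ => 1) fun _ _ => rfl)
    simp only [zero_smul] at this
    exact ⟨zero_mem _, this⟩
  | add x y _ _ hx hy => exact ⟨_, add x y _ _ hx.2 hy.2⟩
  | smul c x _ hx => exact ⟨_, smul c x _ hx.2⟩

theorem localOps_mono {C D : Finset V} (h : C ⊆ D) : localOps d C ≤ localOps d D := by
  intro X hX
  induction hX using localOps_induction with
  | prod M hM => exact prodOp_mem fun v hv => hM v fun hc => hv (h hc)
  | add X Y _ _ hX hY => exact add_mem hX hY
  | smul c X _ hX => exact Submodule.smul_mem _ c hX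

theorem one_mem_localOps (C : Finset V) : (1 : Op V d) ∈ localOps d C := by
  rw [← prodOp_one]
  exact prodOp_mem fun _ _ => rfl

theorem localOps_empty {X : Op V d} (hX : X ∈ localOps d ∅) : ∃ c : ℂ, X = c • (1 : Op V d) := by
  induction hX using localOps_induction with
  | prod M hM =>
    refine ⟨1, ?_⟩
    rw [one_smul, ← prodOp_one]
    congr 1
    ext1 v
    exact hM v (by simp)
  | add X Y _ _ hX hY =>
    obtain ⟨a, rfl⟩ := hX
    obtain ⟨b, rfl⟩ := hY
    exact ⟨a + b, (add_smul _ _ _).symm⟩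
  | smul c X _ hX =>
    obtain ⟨a, rfl⟩ := hX
    exact ⟨c * a, (mul_smul _ _ _).symm⟩

theorem mem_localOps_univ (X : Op V d) : X ∈ localOps d Finset.univ := by
  rw [Matrix.matrix_eq_sum_single X]
  refine Submodule.sum_mem _ fun a _ => Submodule.sum_mem _ fun b _ => ?_
  have h : Matrix.single a b (X a b) = X a b • Matrix.single a b (1 : ℂ) := by
    simp [Matrix.smul_single]
  rw [h, single_eq_prodOp]
  exact Submodule.smul_mem _ _ (prodOp_mem fun v hv => absurd (Finset.mem_univ v) hv)

theorem conjTranspose_mem {C : Finset V} {X : Op V d} (hX : X ∈ localOps d C) :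
    X.conjTranspose ∈ localOps d C := by
  induction hX using localOps_induction with
  | prod M hM =>
    rw [conjTranspose_prodOp]
    exact prodOp_mem fun v hv => by simp [hM v hv]
  | add X Y _ _ hX hY => rw [Matrix.conjTranspose_add]; exact add_mem hX hY
  | smul c X _ hX => rw [Matrix.conjTranspose_smul]; exact Submodule.smul_mem _ _ hX

theorem localOps_induction₂ {C D : Finset V}
    {p : (X Y : Op V d) → X ∈ localOps d C → Y ∈ localOps d D → Prop}
    (prod : ∀ (M N : V → Matrix (Fin d) (Fin d) ℂ) (hM : ∀ v, v ∉ C → M v = 1)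
      (hN : ∀ v, v ∉ D → N v = 1), p (prodOp M) (prodOp N) (prodOp_mem hM) (prodOp_mem hN))
    (add_left : ∀ X X' Y hX hX' hY, p X Y hX hY → p X' Y hX' hY →
      p (X + X') Y (add_mem hX hX') hY)
    (smul_left : ∀ (c : ℂ) X Y hX hY, p X Y hX hY → p (c • X) Y (Submodule.smul_mem _ c hX) hY)
    (add_right : ∀ X Y Y' hX hY hY', p X Y hX hY → p X Y' hX hY' →
      p X (Y + Y') hX (add_mem hY hY'))
    (smul_right : ∀ (c : ℂ) X Y hX hY, p X Y hX hY → p X (c • Y) hX (Submodule.smul_mem _ c hY))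
    {X Y : Op V d} (hX : X ∈ localOps d C) (hY : Y ∈ localOps d D) : p X Y hX hY := by
  induction hX using localOps_induction with
  | prod M hM =>
    induction hY using localOps_induction with
    | prod N hN => exact prod M N hM hN
    | add Y Y' _ _ h h' => exact add_right _ _ _ _ _ _ h h'
    | smul c Y _ h => exact smul_right _ _ _ _ _ h
  | add X X' _ _ h h' => exact add_left _ _ _ _ _ _ h h'
  | smul c X _ h => exact smul_left _ _ _ _ _ h

theorem mul_mem_localOps_union {C D : Finset V} {X Y : Op V d} (hX : X ∈ localOps d C)
    (hY : Y ∈ localOps d D) : X * Y ∈ localOps d (C ∪ D) := by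
  induction hX, hY using localOps_induction₂ with
  | prod M N hM hN =>
    rw [prodOp_mul]
    refine prodOp_mem fun v hv => ?_
    rw [Finset.mem_union, not_or] at hv
    rw [hM v hv.1, hN v hv.2, one_mul]
  | add_left X X' Y _ _ _ h h' => rw [add_mul]; exact add_mem h h'
  | smul_left c X Y _ _ h => rw [smul_mul_assoc]; exact Submodule.smul_mem _ _ h
  | add_right X Y Y' _ _ _ h h' => rw [mul_add]; exact add_mem h h'
  | smul_right c X Y _ _ h => rw [mul_smul_comm]; exact Submodule.smul_mem _ _ h

theorem localOps_commute {C D : Finset V} (hCD : Disjoint C D) {X Y : Op V d}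
    (hX : X ∈ localOps d C) (hY : Y ∈ localOps d D) : X * Y = Y * X := by
  induction hX, hY using localOps_induction₂ with
  | prod M N hM hN =>
    rw [prodOp_mul, prodOp_mul]
    congr 1
    ext1 v
    by_cases hv : v ∈ C
    · rw [hN v (Finset.disjoint_left.1 hCD hv), one_mul, mul_one]
    · rw [hM v hv, one_mul, mul_one]
  | add_left X X' Y _ _ _ h h' => rw [add_mul, mul_add, h, h']
  | smul_left c X Y _ _ h => rw [smul_mul_assoc, mul_smul_comm, h]
  | add_right X Y Y' _ _ _ h h' => rw [add_mul, mul_add, h, h']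
  | smul_right c X Y _ _ h => rw [smul_mul_assoc, mul_smul_comm, h]

/-- On products this is checked at each site, where at least one of the two factors is the identity
and contributes the trace `d`. -/
theorem trace_mul_of_disjoint {C D : Finset V} (hCD : Disjoint C D) {X Y : Op V d}
    (hX : X ∈ localOps d C) (hY : Y ∈ localOps d D) :
    (d : ℂ) ^ Fintype.card V * (X * Y).trace = X.trace * Y.trace := by
  induction hX, hY using localOps_induction₂ with
  | prod M N hM hN =>
    rw [prodOp_mul, trace_prodOp, trace_prodOp, trace_prodOp, ← Finset.prod_mul_distrib,
      ← Finset.card_univ, ← Finset.prod_const, ← Finset.prod_mul_distrib]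
    refine Finset.prod_congr rfl fun v _ => ?_
    by_cases hv : v ∈ C
    · simp [hN v (Finset.disjoint_left.1 hCD hv), mul_comm]
    · simp [hM v hv]
  | add_left X X' Y _ _ _ h h' => rw [add_mul, Matrix.trace_add, mul_add, h, h', Matrix.trace_add]; ring
  | smul_left c X Y _ _ h =>
    rw [smul_mul_assoc, Matrix.trace_smul, Matrix.trace_smul, smul_eq_mul, smul_eq_mul, mul_assoc,
      ← h]
    ring
  | add_right X Y Y' _ _ _ h h' => rw [mul_add, Matrix.trace_add, mul_add, h, h', Matrix.trace_add]; ring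
  | smul_right c X Y _ _ h =>
    rw [mul_smul_comm, Matrix.trace_smul, Matrix.trace_smul, smul_eq_mul, smul_eq_mul,
      mul_left_comm, h]
    ring

theorem trace_single_mul (a b : V → Fin d) (X : Op V d) :
    (Matrix.single a b (1 : ℂ) * X).trace = X b a := by
  simp [Matrix.trace_single_mul]

theorem eq_of_forall_trace_mul {X Y : Op V d} (h : ∀ Z : Op V d, (X * Z).trace = (Y * Z).trace) :
    X = Y := by
  ext s t
  rw [← trace_single_mul t s X, ← trace_single_mul t s Y, Matrix.trace_mul_comm, h,
    Matrix.trace_mul_comm]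

/-- Operators are separated by their traces against products of operators on complementary
regions. -/
theorem eq_of_forall_trace_mul_mul {C D : Finset V} (hCD : C ∪ D = Finset.univ) {X Y : Op V d}
    (h : ∀ P ∈ localOps d C, ∀ Q ∈ localOps d D,
      (X * (P * Q)).trace = (Y * (P * Q)).trace) : X = Y := by
  refine eq_of_forall_trace_mul fun Z => ?_
  have hZ := mem_localOps_univ Z
  induction hZ using localOps_induction with
  | prod M hM =>
    have : prodOp M = prodOp (fun v => if v ∈ C then M v else 1) *
        prodOp (fun v => if v ∈ C then 1 else M v) := by
      rw [prodOp_mul]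
      congr 1
      ext1 v
      split_ifs <;> simp
    rw [this]
    refine h _ (prodOp_mem fun v hv => by simp [hv]) _ (prodOp_mem fun v hv => ?_)
    have : v ∈ C := by
      have := Finset.mem_univ v
      rw [← hCD, Finset.mem_union] at this
      tauto
    simp [this]
  | add X Y _ _ h h' => simp only [mul_add, Matrix.trace_add, h, h']
  | smul c X _ h => simp only [mul_smul_comm, Matrix.trace_smul, h]

/-- Lets the positivity of the inputs in the definition of LPQC be dropped, since that condition is
bilinear in them. -/
theorem span_posSemidef (n : Type*) [Fintype n] [DecidableEq n] :
    Submodule.span ℂ {X : Matrix n n ℂ | X.PosSemidef} = ⊤ := by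
  open scoped MatrixOrder Matrix.Norms.L2Operator in
  have h := CStarAlgebra.span_nonneg (A := Matrix n n ℂ)
  simpa only [Matrix.nonneg_iff_posSemidef] using h

end LocalOperators

/-! ### The Heisenberg picture and the equality fQC = LPQC -/

section Dual

variable {V : Type*} [Fintype V] [DecidableEq V] {d : ℕ}

/-- The adjoint of `E` for the bilinear pairing `tr (X Y)`. -/
noncomputable def dual (E : Op V d →ₗ[ℂ] Op V d) (X : Op V d) : Op V d :=
  (adj E X.conjTranspose).conjTranspose

theorem trace_dual_mul (E : Op V d →ₗ[ℂ] Op V d) (X Y : Op V d) :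
    (dual E X * Y).trace = (X * E Y).trace := by
  rw [dual, trace_adj, Matrix.conjTranspose_conjTranspose]

theorem adj_eq_dual (E : Op V d →ₗ[ℂ] Op V d) (X : Op V d) :
    adj E X = (dual E X.conjTranspose).conjTranspose := by
  simp [dual]

theorem dual_eq_of_forall {E : Op V d →ₗ[ℂ] Op V d} {X Z : Op V d}
    (h : ∀ Y, (Z * Y).trace = (X * E Y).trace) : dual E X = Z :=
  eq_of_forall_trace_mul fun Y => by rw [trace_dual_mul, h]

theorem dual_smul (E : Op V d →ₗ[ℂ] Op V d) (c : ℂ) (X : Op V d) :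
    dual E (c • X) = c • dual E X :=
  dual_eq_of_forall fun Y => by
    rw [smul_mul_assoc, smul_mul_assoc, Matrix.trace_smul, Matrix.trace_smul, trace_dual_mul]

theorem dual_one {E : Op V d →ₗ[ℂ] Op V d} (hE : IsChannel E) : dual E 1 = 1 :=
  dual_eq_of_forall fun Y => by rw [one_mul, one_mul, hE.trace_eq]

theorem mem_CPQC_iff {G : SimpleGraph V} {E : Op V d →ₗ[ℂ] Op V d} :
    E ∈ CPQC G d ↔ IsChannel E ∧ ∀ A ∈ regS G, ∀ X ∈ localOps d A,
      dual E X ∈ localOps d (regAbar G A) := by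
  refine and_congr_right fun _ => forall₂_congr fun A _ => ?_
  constructor
  · intro h X hX
    obtain ⟨X, hX⟩ := mem_localOps.1 (conjTranspose_mem hX)
    rw [dual, hX]
    exact conjTranspose_mem (mem_localOps.2 (h X))
  · intro h X
    rw [← mem_localOps, adj_eq_dual]
    exact conjTranspose_mem (h _ (conjTranspose_mem (embed_mem A X)))

theorem mem_fQC_iff {G : SimpleGraph V} {E : Op V d →ₗ[ℂ] Op V d} :
    E ∈ fQC G d ↔ E ∈ CPQC G d ∧ ∀ A ∈ regS G, ∀ X ∈ localOps d A, ∀ Y ∈ localOps d (regB G A),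
      dual E (Y * X) = dual E Y * dual E X := by
  refine and_congr_right fun _ => forall₂_congr fun A _ => ?_
  constructor
  · intro h X hX Y hY
    obtain ⟨X, hX⟩ := mem_localOps.1 (conjTranspose_mem hX)
    obtain ⟨Y, hY⟩ := mem_localOps.1 (conjTranspose_mem hY)
    rw [dual, dual, dual, ← Matrix.conjTranspose_mul, Matrix.conjTranspose_mul, hX, hY, h]
  · intro h X Y
    rw [adj_eq_dual, adj_eq_dual, adj_eq_dual, Matrix.conjTranspose_mul,
      h _ (conjTranspose_mem (embed_mem A X)) _ (conjTranspose_mem (embed_mem _ Y)),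
      Matrix.conjTranspose_mul]

theorem sum_glue (K : Finset V) (f : (V → Fin d) → ℂ) :
    ∑ s, f s = ∑ a : K → Fin d, ∑ u : {v // v ∉ K} → Fin d, f (glue a u) := by
  rw [← Fintype.sum_prod_type']
  exact (Equiv.sum_comp (Equiv.piEquivPiSubtypeProd (· ∈ K) fun _ => Fin d).symm f).symm

/-- The partial trace is the transpose of `embed` for the trace pairing, so equations between
reduced operators become equations between expectations of local observables. -/
theorem trace_embed_mul (K : Finset V) (X : Op K d) (Z : Op V d) :
    (embed K X * Z).trace = (X * reduce K Z).trace := by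
  have h1 : ∀ (a : K → Fin d) (u : {v // v ∉ K} → Fin d), (fun v : K => glue a u v) = a :=
    fun a u => by ext1 v; simp [glue]
  have h2 : ∀ (a b : K → Fin d) (u w : {v // v ∉ K} → Fin d),
      (∀ v, v ∉ K → glue a u v = glue b w v) ↔ u = w := by
    intro a b u w
    constructor
    · intro h
      ext1 v
      simpa [glue, v.2] using h v v.2
    · rintro rfl v hv
      simp [glue, hv]
  simp only [Matrix.trace, Matrix.diag_apply, Matrix.mul_apply]
  rw [sum_glue K]
  refine Finset.sum_congr rfl fun a _ => ?_
  simp only [sum_glue K (fun j => embed K X _ j * Z j _)]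
  rw [Finset.sum_comm]
  refine Finset.sum_congr rfl fun b _ => ?_
  simp only [embed, Matrix.of_apply, h1, h2, reduce, Finset.mul_sum]
  refine Finset.sum_congr rfl fun u _ => ?_
  simp

theorem embed_single_mul_embed_single {A B : Finset V} (hAB : Disjoint A B)
    (s t : (A ∪ B : Finset V) → Fin d) :
    embed (A ∪ B) (Matrix.single s t (1 : ℂ)) =
      embed A (Matrix.single (fun v => s ⟨v, Finset.mem_union_left B v.2⟩)
        (fun v => t ⟨v, Finset.mem_union_left B v.2⟩) 1) *
      embed B (Matrix.single (fun v => s ⟨v, Finset.mem_union_right A v.2⟩)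
        (fun v => t ⟨v, Finset.mem_union_right A v.2⟩) 1) := by
  simp only [single_eq_prodOp, embed_prodOp, prodOp_mul]
  congr 1
  ext1 v
  by_cases hA : v ∈ A
  · have hB := Finset.disjoint_left.1 hAB hA
    simp [extendOne, hA, hB]
  · by_cases hB : v ∈ B <;> simp [extendOne, hA, hB]

theorem reduce_apply (K : Finset V) (Z : Op V d) (s t : K → Fin d) :
    reduce K Z s t = (embed K (Matrix.single t s 1) * Z).trace := by
  rw [trace_embed_mul, Matrix.trace_single_mul, one_smul]

theorem mem_regAbar {G : SimpleGraph V} {A : Finset V} {v : V} :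
    v ∈ regAbar G A ↔ ∃ m ∈ A, G.edist v m ≤ 1 := by
  simp only [regAbar, collar, Finset.mem_union, Finset.mem_filter, Finset.mem_univ, true_and,
    Nat.cast_one]
  constructor
  · rintro (h | h)
    · exact ⟨v, h, by simp⟩
    · exact h.2
  · intro h
    tauto

theorem mem_regB {G : SimpleGraph V} {A : Finset V} {v : V} :
    v ∈ regB G A ↔ ∀ m ∈ A, ¬ G.edist v m ≤ 2 := by
  simp only [regB, regb, Finset.mem_compl, Finset.mem_union, Finset.mem_sdiff, mem_regAbar]
  simp only [collar, Finset.mem_filter, Finset.mem_univ, true_and, Nat.cast_one, Nat.cast_ofNat]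
  constructor
  · intro h m hm hvm
    by_cases h1 : ∃ m ∈ A, G.edist v m ≤ 1
    · exact h (Or.inl h1)
    · have hv : v ∉ A := fun hv => h1 ⟨v, hv, by simp⟩
      exact h (Or.inr ⟨⟨hv, m, hm, hvm⟩, fun h' => h1 h'.2⟩)
  · rintro h (⟨m, hm, h'⟩ | ⟨⟨_, m, hm, h'⟩, _⟩)
    · exact h m hm (h'.trans (by norm_num))
    · exact h m hm h'

theorem mem_regS {G : SimpleGraph V} {A : Finset V} :
    A ∈ regS G ↔ ∃ v, ∀ m ∈ A, ¬ G.edist v m ≤ 2 := by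
  simp only [regS, Set.mem_ofPred_eq, Finset.Nonempty, mem_regB]

theorem disjoint_regB {G : SimpleGraph V} {A : Finset V} : Disjoint A (regB G A) := by
  rw [Finset.disjoint_left]
  intro v hv h
  simp [regB, regAbar, hv] at h

theorem regBbar_eq {G : SimpleGraph V} {A : Finset V} : regBbar G A = (regAbar G A)ᶜ := by
  ext v
  simp only [regBbar, regB, regAbar, regb, Finset.mem_union, Finset.mem_compl, Finset.mem_sdiff]
  have : v ∈ collar G 2 A → v ∉ A := fun h => by
    simp only [collar, Finset.mem_filter] at h
    exact h.2.1
  tauto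

/-- Pairing the reduced outputs with observables `X` and `Y` tests all their matrix elements; both
sides are then linear in each of the four operators, so matrix units suffice for `X`, `Y` and
positive operators for `ρ`, `τ`. -/
theorem mem_LPQC_iff {G : SimpleGraph V} {E : Op V d →ₗ[ℂ] Op V d} :
    E ∈ LPQC G d ↔ IsChannel E ∧ ∀ A ∈ regS G, ∀ ρ ∈ localOps d (regAbar G A),
      ∀ τ ∈ localOps d (regBbar G A), ∀ X ∈ localOps d A, ∀ Y ∈ localOps d (regB G A),
      (X * Y * E (ρ * τ)).trace =
        1 / (d : ℂ) ^ Fintype.card V * ((X * E ρ).trace * (Y * E τ).trace) := by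
  refine and_congr_right fun _ => forall₂_congr fun A _ => ?_
  constructor
  · intro h ρ hρ τ hτ X hX Y hY
    obtain ⟨ρ, rfl⟩ := mem_localOps.1 hρ
    obtain ⟨τ, rfl⟩ := mem_localOps.1 hτ
    obtain ⟨X, rfl⟩ := mem_localOps.1 hX
    obtain ⟨Y, rfl⟩ := mem_localOps.1 hY
    clear hρ hτ hX hY
    simp only [← embedLin_apply]
    induction X using Matrix.induction_on' with
    | h_zero => simp
    | h_add X X' hX hX' => simp only [map_add, add_mul, Matrix.trace_add, mul_add, hX, hX']
    | h_std_basis a a' x =>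
    induction Y using Matrix.induction_on' with
    | h_zero => simp
    | h_add X X' hX hX' => simp only [map_add, add_mul, Matrix.trace_add, mul_add, hX, hX']
    | h_std_basis b b' y =>
    have hx : Matrix.single a a' x = x • Matrix.single a a' (1 : ℂ) := by
      simp [Matrix.smul_single]
    have hy : Matrix.single b b' y = y • Matrix.single b b' (1 : ℂ) := by
      simp [Matrix.smul_single]
    rw [hx, hy]
    simp only [map_smul, smul_mul_assoc, mul_smul_comm, Matrix.trace_smul, smul_eq_mul]
    suffices H : (embedLin A (Matrix.single a a' 1) * embedLin (regB G A) (Matrix.single b b' 1) *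
        E (embedLin (regAbar G A) ρ * embedLin (regBbar G A) τ)).trace =
        1 / (d : ℂ) ^ Fintype.card V *
          ((embedLin A (Matrix.single a a' 1) * E (embedLin (regAbar G A) ρ)).trace *
          (embedLin (regB G A) (Matrix.single b b' 1) *
            E (embedLin (regBbar G A) τ)).trace) by
      rw [H]; ring
    have hρ : ρ ∈ Submodule.span ℂ {X : Op (regAbar G A) d | X.PosSemidef} := by
      rw [span_posSemidef]; trivial
    have hτ : τ ∈ Submodule.span ℂ {X : Op (regBbar G A) d | X.PosSemidef} := by
      rw [span_posSemidef]; trivial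
    induction hρ using Submodule.span_induction with
    | zero => simp
    | add x y _ _ hx hy => simp only [map_add, add_mul, mul_add, Matrix.trace_add, hx, hy]
    | smul c x _ hx =>
      simp only [map_smul, smul_mul_assoc, mul_smul_comm, Matrix.trace_smul, smul_eq_mul, hx]; ring
    | mem ρ hρ =>
    induction hτ using Submodule.span_induction with
    | zero => simp
    | add x y _ _ hx hy => simp only [map_add, mul_add, Matrix.trace_add, hx, hy]
    | smul c x _ hx =>
      simp only [map_smul, mul_smul_comm, Matrix.trace_smul, smul_eq_mul, hx]; ring
    | mem τ hτ =>
    have H := h ρ τ hρ hτ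
    -- Joins labels of the disjoint regions `A` and `B`, so that an entry of the matrix equation `H`
    -- is the claim for a pair of matrix units.
    let f : (A → Fin d) → (regB G A → Fin d) → ((A ∪ regB G A : Finset V) → Fin d) :=
      fun a b v => if hv : v.1 ∈ A then a ⟨v, hv⟩ else
        b ⟨v, (Finset.mem_union.1 v.2).resolve_left hv⟩
    have hf1 : ∀ a b, (fun v : A => f a b ⟨v, Finset.mem_union_left _ v.2⟩) = a :=
      fun a b => by ext1 v; simp [f]
    have hf2 : ∀ a b, (fun v : regB G A => f a b ⟨v, Finset.mem_union_right _ v.2⟩) = b :=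
      fun a b => by ext1 v; simp [f, Finset.disjoint_right.1 disjoint_regB v.2]
    have H' := congrFun (congrFun H (f a' b')) (f a b)
    simpa only [Matrix.smul_apply, tensor, Matrix.of_apply, smul_eq_mul, reduce_apply,
      embed_single_mul_embed_single disjoint_regB, hf1, hf2, embedLin_apply] using H'
  · intro h ρ τ _ _
    have H := h _ (embed_mem _ ρ) _ (embed_mem _ τ)
    ext s t
    rw [Matrix.smul_apply, tensor, Matrix.of_apply, smul_eq_mul, reduce_apply, reduce_apply,
      reduce_apply, embed_single_mul_embed_single disjoint_regB]
    exact H _ (embed_mem _ _) _ (embed_mem _ _)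

theorem disjoint_regAbar_regBbar {G : SimpleGraph V} {A : Finset V} :
    Disjoint (regAbar G A) (regBbar G A) := by
  rw [regBbar_eq]
  exact disjoint_compl_right

/-- A site within distance 1 of both `A` and `B` would put them within distance 2 of each other. -/
theorem regAbar_regB_subset {G : SimpleGraph V} {A : Finset V} :
    regAbar G (regB G A) ⊆ regBbar G A := by
  intro n hn
  obtain ⟨m, hm, hnm⟩ := mem_regAbar.1 hn
  rw [regBbar_eq, Finset.mem_compl, mem_regAbar]
  rintro ⟨a, ha, hna⟩
  refine mem_regB.1 hm a ha ((SimpleGraph.edist_triangle (v := n)).trans ?_)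
  rw [SimpleGraph.edist_comm (u := m)]
  exact (add_le_add hnm hna).trans (by norm_num)

theorem regB_mem_regS {G : SimpleGraph V} {A : Finset V} (hA : A.Nonempty) :
    regB G A ∈ regS G := by
  obtain ⟨a, ha⟩ := hA
  refine mem_regS.2 ⟨a, fun m hm h => mem_regB.1 hm a ha ?_⟩
  rwa [SimpleGraph.edist_comm]

theorem regBbar_empty {G : SimpleGraph V} : regBbar G ∅ = Finset.univ := by
  ext v
  simp [regBbar_eq, mem_regAbar]

theorem dual_mem_regBbar {G : SimpleGraph V} {E : Op V d →ₗ[ℂ] Op V d} (hE : E ∈ CPQC G d)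
    {A : Finset V} {Y : Op V d} (hY : Y ∈ localOps d (regB G A)) :
    dual E Y ∈ localOps d (regBbar G A) := by
  rcases A.eq_empty_or_nonempty with rfl | hA
  · rw [regBbar_empty]
    exact mem_localOps_univ _
  · exact localOps_mono regAbar_regB_subset ((mem_CPQC_iff.1 hE).2 _ (regB_mem_regS hA) _ hY)

/-- The duals of `X` and `Y` live on the complementary regions `Ā` and `B̄`, as do `ρ` and `τ`.
Cyclicity of the trace groups the four operators by region, and the trace factorizes. -/
theorem fQC_subset_LPQC (G : SimpleGraph V) (hd : d ≠ 0) : fQC G d ⊆ LPQC G d := by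
  intro E hE
  obtain ⟨hE, hmul⟩ := mem_fQC_iff.1 hE
  obtain ⟨hch, hloc⟩ := mem_CPQC_iff.1 hE
  refine mem_LPQC_iff.2 ⟨hch, fun A hA ρ hρ τ hτ X hX Y hY => ?_⟩
  have hX' := hloc A hA X hX
  have hY' := dual_mem_regBbar hE hY
  have hN : (d : ℂ) ^ Fintype.card V ≠ 0 := pow_ne_zero _ (Nat.cast_ne_zero.2 hd)
  rw [one_div, eq_inv_mul_iff_mul_eq₀ hN, localOps_commute disjoint_regB hX hY, ← trace_dual_mul,
    hmul A hA X hX Y hY, ← trace_dual_mul, ← trace_dual_mul, Matrix.trace_mul_comm (dual E Y)]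
  have h1 : dual E Y * dual E X * (ρ * τ) = dual E Y * ((dual E X * ρ) * τ) := by
    simp only [mul_assoc]
  have h2 : dual E X * ρ * τ * dual E Y = dual E X * ρ * (τ * dual E Y) := by
    simp only [mul_assoc]
  rw [h1, Matrix.trace_mul_comm, h2]
  have hXρ := mul_mem_localOps_union hX' hρ
  have hτY := mul_mem_localOps_union hτ hY'
  rw [Finset.union_self] at hXρ hτY
  exact trace_mul_of_disjoint disjoint_regAbar_regBbar hXρ hτY

/-- The witness is the normalized partial trace over the complement of `K`: on products, every
factor outside `K` is replaced by its trace divided by `d`. -/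
theorem exists_localOps_trace_eq (hd : d ≠ 0) (K : Finset V) (X : Op V d) :
    ∃ Z ∈ localOps d K, ∀ ρ ∈ localOps d K, (X * ρ).trace = (Z * ρ).trace := by
  have hX := mem_localOps_univ X
  have hd' : (d : ℂ) ≠ 0 := Nat.cast_ne_zero.2 hd
  induction hX using localOps_induction with
  | prod M _ =>
    refine ⟨(∏ v ∈ Kᶜ, (M v).trace / d) • prodOp fun v => if v ∈ K then M v else 1,
      Submodule.smul_mem _ _ (prodOp_mem fun v hv => by simp [hv]), fun ρ hρ => ?_⟩
    induction hρ using localOps_induction with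
    | prod N hN =>
      rw [smul_mul_assoc, Matrix.trace_smul, prodOp_mul, prodOp_mul, trace_prodOp, trace_prodOp,
        ← Finset.prod_mul_prod_compl K, ← Finset.prod_mul_prod_compl K, smul_eq_mul,
        mul_left_comm, ← Finset.prod_mul_distrib]
      congr 1
      · exact Finset.prod_congr rfl fun v hv => by simp [hv]
      · refine Finset.prod_congr rfl fun v hv => ?_
        simp [Finset.mem_compl.1 hv, hN v (Finset.mem_compl.1 hv), hd']
    | add X Y _ _ h h' => simp only [mul_add, Matrix.trace_add, h, h']
    | smul c X _ h => simp only [mul_smul_comm, Matrix.trace_smul, h]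
  | add X Y _ _ h h' =>
    obtain ⟨Z, hZ, h⟩ := h
    obtain ⟨Z', hZ', h'⟩ := h'
    exact ⟨Z + Z', add_mem hZ hZ', fun ρ hρ => by
      rw [add_mul, add_mul, Matrix.trace_add, Matrix.trace_add, h ρ hρ, h' ρ hρ]⟩
  | smul c X _ h =>
    obtain ⟨Z, hZ, h⟩ := h
    exact ⟨c • Z, Submodule.smul_mem _ _ hZ, fun ρ hρ => by
      rw [smul_mul_assoc, smul_mul_assoc, Matrix.trace_smul, Matrix.trace_smul, h ρ hρ]⟩

/-- An operator whose correlations with product operators on two complementary regions factorize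
trivially in the second region is supported on the first one. -/
theorem mem_localOps_of_trace_eq (hd : d ≠ 0) {C D : Finset V} (hdisj : Disjoint C D)
    (hCD : C ∪ D = Finset.univ) {X : Op V d}
    (h : ∀ ρ ∈ localOps d C, ∀ τ ∈ localOps d D,
      (d : ℂ) ^ Fintype.card V * (X * (ρ * τ)).trace = (X * ρ).trace * τ.trace) :
    X ∈ localOps d C := by
  obtain ⟨Z, hZ, hXZ⟩ := exists_localOps_trace_eq hd C X
  have hN : (d : ℂ) ^ Fintype.card V ≠ 0 := pow_ne_zero _ (Nat.cast_ne_zero.2 hd)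
  rw [eq_of_forall_trace_mul_mul hCD (X := X) (Y := Z)]
  · exact hZ
  · intro ρ hρ τ hτ
    have hZρ := mul_mem_localOps_union hZ hρ
    rw [Finset.union_self] at hZρ
    rw [← mul_right_inj' hN, h ρ hρ τ hτ, hXZ ρ hρ, ← mul_assoc Z,
      trace_mul_of_disjoint hdisj hZρ hτ]

/-- Taking one of the two observables to be the identity turns factorization into the support
criterion `mem_localOps_of_trace_eq`, which gives causality. With supports known, the product of the
duals has the same pairings with all `ρ τ` as the dual of the product. -/
theorem LPQC_subset_fQC (G : SimpleGraph V) (hd : d ≠ 0) : LPQC G d ⊆ fQC G d := by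
  intro E hE
  obtain ⟨hch, h⟩ := mem_LPQC_iff.1 hE
  have hN : (d : ℂ) ^ Fintype.card V ≠ 0 := pow_ne_zero _ (Nat.cast_ne_zero.2 hd)
  have hun : ∀ A, regAbar G A ∪ regBbar G A = Finset.univ := fun A => by
    rw [regBbar_eq, Finset.union_compl]
  have h' : ∀ A ∈ regS G, ∀ X ∈ localOps d A, ∀ Y ∈ localOps d (regB G A),
      ∀ ρ ∈ localOps d (regAbar G A), ∀ τ ∈ localOps d (regBbar G A),
      (d : ℂ) ^ Fintype.card V * (X * Y * E (ρ * τ)).trace =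
        (dual E X * ρ).trace * (dual E Y * τ).trace := fun A hA X hX Y hY ρ hρ τ hτ => by
    rw [h A hA ρ hρ τ hτ X hX Y hY, one_div, mul_inv_cancel_left₀ hN, trace_dual_mul,
      trace_dual_mul]
  have hX' : ∀ A ∈ regS G, ∀ X ∈ localOps d A, dual E X ∈ localOps d (regAbar G A) :=
    fun A hA X hX => mem_localOps_of_trace_eq hd disjoint_regAbar_regBbar (hun A)
      fun ρ hρ τ hτ => by
        have := h' A hA X hX 1 (one_mem_localOps _) ρ hρ τ hτ
        rwa [mul_one, ← trace_dual_mul, dual_one hch, one_mul] at this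
  have hY' : ∀ A ∈ regS G, ∀ Y ∈ localOps d (regB G A), dual E Y ∈ localOps d (regBbar G A) :=
    fun A hA Y hY => mem_localOps_of_trace_eq hd disjoint_regAbar_regBbar.symm
      (by rw [Finset.union_comm, hun]) fun τ hτ ρ hρ => by
        have := h' A hA 1 (one_mem_localOps _) Y hY ρ hρ τ hτ
        rwa [one_mul, ← trace_dual_mul, dual_one hch, one_mul,
          localOps_commute disjoint_regAbar_regBbar hρ hτ, mul_comm ρ.trace] at this
  refine mem_fQC_iff.2 ⟨mem_CPQC_iff.2 ⟨hch, hX'⟩, fun A hA X hX Y hY => ?_⟩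
  refine eq_of_forall_trace_mul_mul (hun A) fun ρ hρ τ hτ => ?_
  rw [← mul_right_inj' hN, trace_dual_mul, ← localOps_commute disjoint_regB hX hY,
    h' A hA X hX Y hY ρ hρ τ hτ]
  have hXρ := mul_mem_localOps_union (hX' A hA X hX) hρ
  have hYτ := mul_mem_localOps_union (hY' A hA Y hY) hτ
  rw [Finset.union_self] at hXρ hYτ
  rw [← trace_mul_of_disjoint disjoint_regAbar_regBbar hXρ hYτ, mul_assoc (dual E Y),
    ← mul_assoc (dual E X), ← mul_assoc (dual E Y),
    ← localOps_commute disjoint_regAbar_regBbar hXρ (hY' A hA Y hY), mul_assoc _ (dual E Y)]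

theorem fQC_eq_LPQC (G : SimpleGraph V) (hd : d ≠ 0) : fQC G d = LPQC G d :=
  (fQC_subset_LPQC G hd).antisymm (LPQC_subset_fQC G hd)

end Dual

/-! ### State preparation channels: the separating examples -/

section Preparation

variable {V : Type*} [Fintype V] [DecidableEq V] {d : ℕ}

/-- The channel that discards its input and prepares `σ`. -/
noncomputable def prep (σ : Op V d) : Op V d →ₗ[ℂ] Op V d :=
  (Matrix.traceLinearMap (V → Fin d) ℂ ℂ).smulRight σ

theorem prep_apply (σ X : Op V d) : prep σ X = X.trace • σ := rfl

theorem isChannel_prep {σ : Op V d} (hσ : σ.PosSemidef) (htr : σ.trace = 1) :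
    IsChannel (prep σ) where
  trace_eq X := by rw [prep_apply, Matrix.trace_smul, htr, smul_eq_mul, mul_one]
  completelyPositive k X hX := by
    have h : ampliation k (prep σ) X = Matrix.kronecker
        (∑ s : V → Fin d, X.submatrix (fun i : Fin k => (i, s)) fun i => (i, s)) σ := by
      ext p q
      simp [ampliation, prep_apply, Matrix.trace, Matrix.sum_apply]
    rw [h]
    refine Matrix.PosSemidef.kronecker ?_ hσ
    exact Matrix.posSemidef_sum _ fun s _ => hX.submatrix _

theorem dual_prep (σ X : Op V d) : dual (prep σ) X = (X * σ).trace • (1 : Op V d) :=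
  dual_eq_of_forall fun Y => by
    rw [smul_mul_assoc, one_mul, prep_apply, mul_smul_comm, Matrix.trace_smul, Matrix.trace_smul,
      smul_eq_mul, smul_eq_mul, mul_comm]

/-- The dual sends every observable to a scalar, its expectation in `σ`, and scalars are supported
everywhere. -/
theorem prep_mem_CPQC {σ : Op V d} (hσ : σ.PosSemidef) (htr : σ.trace = 1) (G : SimpleGraph V) :
    prep σ ∈ CPQC G d :=
  mem_CPQC_iff.2 ⟨isChannel_prep hσ htr, fun A _ X _ => by
    rw [dual_prep]
    exact Submodule.smul_mem _ _ (one_mem_localOps _)⟩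

theorem prep_mem_fQC_iff [NeZero d] {σ : Op V d} (hσ : σ.PosSemidef) (htr : σ.trace = 1)
    {G : SimpleGraph V} :
    prep σ ∈ fQC G d ↔ ∀ A ∈ regS G, ∀ X ∈ localOps d A, ∀ Y ∈ localOps d (regB G A),
      (Y * X * σ).trace = (Y * σ).trace * (X * σ).trace := by
  rw [mem_fQC_iff, and_iff_right (prep_mem_CPQC hσ htr G)]
  refine forall₂_congr fun A _ => forall₄_congr fun X _ Y _ => ?_
  rw [dual_prep, dual_prep, dual_prep, smul_mul_assoc, one_mul, smul_smul]
  refine ⟨fun h => ?_, fun h => by rw [h]⟩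
  have := congrFun (congrFun h fun _ => 0) fun _ => 0
  simpa using this

theorem choi_prep (σ : Op V d) (p q : (V → Fin d) × (V → Fin d)) :
    choi (prep σ) p q = if p.2 = q.2 then σ p.1 q.1 else 0 := by
  rw [choi, Matrix.of_apply, prep_apply, Matrix.smul_apply]
  split_ifs with h
  · rw [h, Matrix.trace_single_eq_same, one_smul]
  · rw [Matrix.trace_single_eq_of_ne _ _ _ h, zero_smul]

/-- The maximally mixed state. -/
noncomputable def maxMixed (V : Type*) [Fintype V] [DecidableEq V] (d : ℕ) : Op V d :=
  ((d : ℂ) ^ Fintype.card V)⁻¹ • (1 : Op V d)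

theorem trace_one_op : (1 : Op V d).trace = (d : ℂ) ^ Fintype.card V := by
  rw [Matrix.trace_one]
  simp

theorem posSemidef_maxMixed : (maxMixed V d).PosSemidef := by
  refine Matrix.PosSemidef.one.smul ?_
  rw [← Nat.cast_pow]
  exact inv_nonneg.2 (Nat.cast_nonneg _)

theorem trace_maxMixed (hd : d ≠ 0) : (maxMixed V d).trace = 1 := by
  rw [maxMixed, Matrix.trace_smul, trace_one_op, smul_eq_mul,
    inv_mul_cancel₀ (pow_ne_zero _ (Nat.cast_ne_zero.2 hd))]

theorem prep_maxMixed_mem_fQC [NeZero d] (G : SimpleGraph V) : prep (maxMixed V d) ∈ fQC G d := by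
  rw [prep_mem_fQC_iff posSemidef_maxMixed (trace_maxMixed (NeZero.ne d))]
  intro A _ X hX Y hY
  have hN : (d : ℂ) ^ Fintype.card V ≠ 0 := pow_ne_zero _ (Nat.cast_ne_zero.2 (NeZero.ne d))
  have h := trace_mul_of_disjoint disjoint_regB.symm hY hX
  simp only [maxMixed, mul_smul_comm, mul_one, Matrix.trace_smul, smul_eq_mul]
  field_simp
  rw [← h]

open Classical in
theorem isPEPO_maxMixed (G : SimpleGraph V) : IsPEPO G 1 (choi (prep (maxMixed V d))) := by
  refine ⟨fun v _ => (d : ℂ)⁻¹ • 1, fun p q => ?_⟩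
  rw [Fintype.sum_unique]
  simp only [choi_prep, maxMixed, Matrix.smul_apply, smul_eq_mul, Finset.prod_mul_distrib,
    Finset.prod_const, Finset.card_univ, Matrix.one_apply, Finset.prod_ite_zero,
    Prod.mk.injEq, Finset.mem_univ, true_implies, forall_and, inv_pow,
    funext_iff]
  split_ifs <;> first | rfl | simp_all

/-- The classical mixture with equal weights of two constant basis states. -/
noncomputable def twoPhase (V : Type*) [Fintype V] [DecidableEq V] {d : ℕ} (x y : Fin d) :
    Op V d :=
  (1 / 2 : ℂ) • (Matrix.single (fun _ => x) (fun _ => x) 1 +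
    Matrix.single (fun _ => y) (fun _ => y) 1)

theorem posSemidef_single {n : Type*} [Fintype n] [DecidableEq n] (a : n) :
    (Matrix.single a a (1 : ℂ)).PosSemidef := by
  rw [← Matrix.diagonal_single]
  refine Matrix.PosSemidef.diagonal fun i => ?_
  by_cases h : i = a
  · subst h; simp
  · simp [h]

theorem posSemidef_twoPhase (x y : Fin d) : (twoPhase V x y).PosSemidef := by
  refine ((posSemidef_single _).add (posSemidef_single _)).smul ?_
  rw [one_div]
  exact inv_nonneg.2 zero_le_two

theorem trace_mul_twoPhase (x y : Fin d) (X : Op V d) :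
    (X * twoPhase V x y).trace = 1 / 2 * (X (fun _ => x) (fun _ => x) +
      X (fun _ => y) fun _ => y) := by
  rw [twoPhase, mul_smul_comm, Matrix.trace_smul, mul_add, Matrix.trace_add, Matrix.trace_mul_comm,
    trace_single_mul, Matrix.trace_mul_comm, trace_single_mul, smul_eq_mul]

theorem trace_twoPhase (x y : Fin d) : (twoPhase V x y).trace = 1 := by
  have := trace_mul_twoPhase x y (1 : Op V d)
  rw [one_mul] at this
  rw [this]
  norm_num

/-- The projectors on the basis vector `x` at two distant sites have expectation 1/2 each, and their
product has 1/2 rather than 1/4. -/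
theorem prep_twoPhase_notMem_fQC {G : SimpleGraph V} {x y : Fin d} (hxy : x ≠ y) {n m : V}
    (hnm : ¬ G.edist m n ≤ 2) : prep (twoPhase V x y) ∉ fQC G d := by
  have : NeZero d := ⟨fun h => by subst h; exact x.elim0⟩
  rw [prep_mem_fQC_iff (posSemidef_twoPhase x y) (trace_twoPhase x y)]
  intro h
  have hne : m ≠ n := by rintro rfl; simp at hnm
  have hB : m ∈ regB G {n} := mem_regB.2 (by simpa using hnm)
  let P : V → V → Matrix (Fin d) (Fin d) ℂ := fun n v => if v = n then Matrix.single x x 1 else 1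
  have hP : ∀ n C, n ∈ C → prodOp (P n) ∈ localOps d C := fun n C hn =>
    prodOp_mem fun v hv => by
      have : v ≠ n := by rintro rfl; exact hv hn
      simp [P, this]
  have hx : ∀ n, prodOp (P n) (fun _ => x) (fun _ => x) = 1 := fun n => by
    rw [prodOp_apply]
    refine Finset.prod_eq_one fun v _ => ?_
    simp only [P]
    split_ifs <;> simp
  have hy : ∀ n, prodOp (P n) (fun _ => y) (fun _ => y) = 0 := fun n => by
    rw [prodOp_apply]
    refine Finset.prod_eq_zero (Finset.mem_univ n) ?_
    simp [P, hxy]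
  have key := h {n} (mem_regS.2 ⟨m, by simpa using hnm⟩) _ (hP n _ (by simp)) _ (hP m _ hB)
  have hxx : (prodOp (P m) * prodOp (P n)) (fun _ => x) (fun _ => x) = 1 := by
    rw [prodOp_mul, prodOp_apply]
    refine Finset.prod_eq_one fun v _ => ?_
    simp only [P]
    split_ifs <;> simp
  have hyy : (prodOp (P m) * prodOp (P n)) (fun _ => y) (fun _ => y) = 0 := by
    rw [prodOp_mul, prodOp_apply]
    refine Finset.prod_eq_zero (Finset.mem_univ n) ?_
    simp [P, hxy, hne.symm]
  rw [trace_mul_twoPhase, trace_mul_twoPhase, trace_mul_twoPhase, hx, hy, hx, hy, hxx, hyy] at key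
  norm_num at key

-- Each edge carries the name of the phase, and a tensor vanishes unless its qudit and all its edges
-- agree on it; connectedness makes the phase global. The weight 1/2 is placed at a single site `r`.
open Classical in
theorem isPEPO_twoPhase {G : SimpleGraph V} (hG : G.Preconnected) [Nonempty V] {x y : Fin d}
    (hxy : x ≠ y) : IsPEPO G 2 (choi (prep (twoPhase V x y))) := by
  obtain ⟨r⟩ := ‹Nonempty V›
  let f : Fin 2 → Fin d := ![x, y]
  have hf : Function.Injective f := by
    intro i j
    fin_cases i <;> fin_cases j <;> simp [f, hxy, hxy.symm]
  refine ⟨fun v η => Matrix.of fun a b => (if v = r then 1 / 2 else 1) *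
    if a = b ∧ ∃ k, a.1 = f k ∧ ∀ i, η i = k then 1 else 0, fun p q => ?_⟩
  simp only [Matrix.of_apply, Finset.prod_mul_distrib, Finset.prod_ite_eq', Finset.mem_univ,
    if_true, Finset.prod_ite_zero, Finset.prod_const_one, true_implies]
  rw [← Finset.mul_sum]
  have hR : choi (prep (twoPhase V x y)) p q =
      1 / 2 * if p = q ∧ ∃ k, p.1 = fun _ => f k then 1 else 0 := by
    have hc : (fun _ : V => x) ≠ fun _ => y := fun h => hxy (congrFun h r)
    rw [choi_prep, twoPhase, Matrix.smul_apply, Matrix.add_apply, Matrix.single_apply,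
      Matrix.single_apply, smul_eq_mul]
    obtain ⟨p, p'⟩ := p
    obtain ⟨q, q'⟩ := q
    simp only [Fin.exists_fin_two, Prod.mk.injEq, f, Matrix.cons_val_zero, Matrix.cons_val_one]
    by_cases h1 : p' = q' <;> by_cases h2 : p = q
    · subst h1 h2
      by_cases h3 : p = fun _ => x
      · subst h3; simp [hc.symm]
      · by_cases h4 : p = fun _ => y
        · subst h4; simp [hc]
        · simp [h3, h4, Ne.symm h3, Ne.symm h4]
    · have h3 : ¬ ((fun _ => x) = p ∧ (fun _ => x) = q) := fun h => h2 (h.1.symm.trans h.2)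
      have h4 : ¬ ((fun _ => y) = p ∧ (fun _ => y) = q) := fun h => h2 (h.1.symm.trans h.2)
      simp [h2, h3, h4]
    · simp [h1]
    · simp [h1]
  rw [hR]
  congr 1
  have hiff : ∀ e : G.edgeSet → Fin 2,
      (∀ v, (p.1 v, p.2 v) = (q.1 v, q.2 v) ∧ ∃ k, p.1 v = f k ∧
        ∀ i : G.incidenceSet v, e ⟨i, G.incidenceSet_subset v i.2⟩ = k) ↔
      p = q ∧ ∃ k, p.1 = (fun _ => f k) ∧ e = fun _ => k := by
    intro e
    constructor
    · intro h
      have hpq : p = q := by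
        ext1 <;> funext v
        · exact congrArg Prod.fst (h v).1
        · exact congrArg Prod.snd (h v).1
      choose _ k hk hk' using h
      have hadj : ∀ v w, G.Adj v w → k v = k w := fun v w hvw => by
        rw [← hk' v ⟨s(v, w), hvw, Sym2.mem_mk_left v w⟩,
          ← hk' w ⟨s(v, w), hvw, Sym2.mem_mk_right v w⟩]
      have hconst : ∀ v, k v = k r := fun v => by
        obtain ⟨W⟩ := hG v r
        induction W with
        | nil => rfl
        | cons h _ ih => rw [hadj _ _ h, ih]
      refine ⟨hpq, k r, ?_, ?_⟩
      · funext v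
        rw [hk, hconst]
      · funext ⟨i, hi⟩
        induction i with
        | _ v w => rw [← hconst v, ← hk' v ⟨s(v, w), hi, Sym2.mem_mk_left v w⟩]
    · rintro ⟨rfl, k, hk, rfl⟩ v
      exact ⟨rfl, k, congrFun hk v, fun _ => rfl⟩
  simp only [hiff]
  by_cases h : p = q ∧ ∃ k, p.1 = fun _ => f k
  · obtain ⟨h1, k, hk⟩ := h
    rw [if_pos ⟨h1, k, hk⟩, Finset.sum_eq_single fun _ => k]
    · rw [if_pos ⟨h1, k, hk, rfl⟩]
    · intro e _ he
      refine if_neg ?_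
      rintro ⟨_, k', hk', rfl⟩
      exact he (by rw [hf (congrFun (hk'.symm.trans hk) r)])
    · simp
  · rw [if_neg h]
    refine (Finset.sum_eq_zero fun e _ => if_neg ?_).symm
    rintro ⟨h1, k, hk, _⟩
    exact h ⟨h1, k, hk⟩

end Preparation

/-! ### Dilations by quantum cellular automata -/

section Dilation

variable {V : Type*} [Fintype V] [DecidableEq V] {d : ℕ}

/-- The basis label of qudits and ancillas with label `s` of the qudits and `u` of the ancillas. -/
def withLabel (s u : V → Fin d) : V × Bool → Fin d :=
  fun p => if p.2 then u p.1 else s p.1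

theorem withLabel_inj {s u s' u' : V → Fin d} :
    withLabel s u = withLabel s' u' ↔ s = s' ∧ u = u' := by
  constructor
  · intro h
    exact ⟨funext fun v => by simpa [withLabel] using congrFun h (v, false),
      funext fun v => by simpa [withLabel] using congrFun h (v, true)⟩
  · rintro ⟨rfl, rfl⟩
    rfl

theorem sum_withLabel (f : (V × Bool → Fin d) → ℂ) :
    ∑ s, f s = ∑ s : V → Fin d, ∑ u : V → Fin d, f (withLabel s u) := by
  rw [← Fintype.sum_prod_type']
  refine (Fintype.sum_bijective (fun x : (V → Fin d) × (V → Fin d) => withLabel x.1 x.2) ?_ _ _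
    fun _ => rfl).symm
  constructor
  · intro a b h
    exact Prod.ext_iff.2 (withLabel_inj.1 h)
  · intro s
    refine ⟨(fun v => s (v, false), fun v => s (v, true)), ?_⟩
    funext ⟨v, b⟩
    cases b <;> rfl

theorem prod_bool_eq (f : V × Bool → ℂ) :
    ∏ p, f p = (∏ v, f (v, false)) * ∏ v, f (v, true) := by
  rw [Fintype.prod_prod_type, ← Finset.prod_mul_distrib]
  exact Finset.prod_congr rfl fun v _ => by simp [mul_comm]

variable [NeZero d]

theorem withAncillas_withLabel (ρ : Op V d) (s u t w : V → Fin d) :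
    withAncillas ρ (withLabel s u) (withLabel t w) =
      if u = (fun _ => 0) ∧ w = (fun _ => 0) then ρ s t else 0 := by
  simp [withAncillas, withLabel, funext_iff, forall_and, Fin.val_eq_zero_iff]

theorem traceAncillas_apply (X : Op (V × Bool) d) (s t : V → Fin d) :
    traceAncillas X s t = ∑ u, X (withLabel s u) (withLabel t u) := rfl

/-- `X ⊗ 1`: an operator on the qudits as an operator on qudits and ancillas. -/
def lift (X : Op V d) : Op (V × Bool) d :=
  Matrix.of fun s t => if ∀ v, s (v, true) = t (v, true) then
    X (fun v => s (v, false)) fun v => t (v, false) else 0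

theorem lift_withLabel (X : Op V d) (s u t w : V → Fin d) :
    lift X (withLabel s u) (withLabel t w) = if u = w then X s t else 0 := by
  simp [lift, withLabel, funext_iff]

/-- The conditional expectation of an operator on qudits and ancillas in the state in which all
ancillas are in the first basis vector. -/
def compress (Z : Op (V × Bool) d) : Op V d :=
  Matrix.of fun s t => Z (withLabel s fun _ => 0) (withLabel t fun _ => 0)

theorem compress_add (Z W : Op (V × Bool) d) : compress (Z + W) = compress Z + compress W := rfl

theorem compress_smul (c : ℂ) (Z : Op (V × Bool) d) : compress (c • Z) = c • compress Z := rfl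

theorem trace_mul_traceAncillas (X : Op V d) (Z : Op (V × Bool) d) :
    (X * traceAncillas Z).trace = (lift X * Z).trace := by
  simp only [Matrix.trace, Matrix.diag_apply, Matrix.mul_apply, sum_withLabel, lift_withLabel,
    traceAncillas_apply, ite_mul, zero_mul, Finset.mul_sum]
  refine Finset.sum_congr rfl fun s _ => ?_
  rw [Finset.sum_comm]
  simp

theorem trace_mul_withAncillas (Z : Op (V × Bool) d) (ρ : Op V d) :
    (Z * withAncillas ρ).trace = (compress Z * ρ).trace := by
  simp only [Matrix.trace, Matrix.diag_apply, Matrix.mul_apply, sum_withLabel,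
    withAncillas_withLabel, compress, Matrix.of_apply, mul_ite, mul_zero]
  refine Finset.sum_congr rfl fun s _ => ?_
  rw [Finset.sum_comm]
  simp [ite_and]

theorem lift_prodOp (M : V → Matrix (Fin d) (Fin d) ℂ) :
    lift (prodOp M) = prodOp fun p => if p.2 then 1 else M p.1 := by
  ext s t
  simp only [lift, Matrix.of_apply, prodOp_apply, prod_bool_eq]
  simp [Matrix.one_apply, Finset.prod_ite_zero]

theorem lift_add (X Y : Op V d) : lift (X + Y) = lift X + lift Y := by
  ext s t
  simp only [lift, Matrix.of_apply, Matrix.add_apply]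
  split_ifs <;> simp

theorem lift_smul (c : ℂ) (X : Op V d) : lift (c • X) = c • lift X := by
  ext s t
  simp [lift]

theorem lift_mul (X Y : Op V d) : lift (X * Y) = lift X * lift Y := by
  have hX := mem_localOps_univ X
  have hY := mem_localOps_univ Y
  induction hX, hY using localOps_induction₂ with
  | prod M N hM hN =>
    rw [prodOp_mul, lift_prodOp, lift_prodOp, lift_prodOp, prodOp_mul]
    congr 1
    ext1 p
    split_ifs <;> simp
  | add_left X X' Y _ _ _ h h' => simp only [lift_add, add_mul, h, h']
  | smul_left c X Y _ _ h => simp only [lift_smul, smul_mul_assoc, h]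
  | add_right X Y Y' _ _ _ h h' => simp only [lift_add, mul_add, h, h']
  | smul_right c X Y _ _ h => simp only [lift_smul, mul_smul_comm, h]

theorem lift_one : lift (1 : Op V d) = 1 := by
  rw [← prodOp_one, lift_prodOp, ← prodOp_one]
  congr 1
  ext1 p
  split_ifs <;> rfl

/-- The qudits of the region `A`, without their ancillas. -/
def qudits (A : Finset V) : Finset (V × Bool) := A ×ˢ {false}

theorem lift_mem {A : Finset V} {X : Op V d} (hX : X ∈ localOps d A) :
    lift X ∈ localOps d (qudits A) := by
  induction hX using localOps_induction with
  | prod M hM =>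
    rw [lift_prodOp]
    refine prodOp_mem fun p hp => ?_
    obtain ⟨v, _ | _⟩ := p
    · simpa using hM v (by simpa [qudits] using hp)
    · simp
  | add X Y _ _ h h' => rw [lift_add]; exact add_mem h h'
  | smul c X _ h => rw [lift_smul]; exact Submodule.smul_mem _ _ h

theorem compress_prodOp (M : V × Bool → Matrix (Fin d) (Fin d) ℂ) :
    compress (prodOp M) = (∏ v, M (v, true) 0 0) • prodOp fun v => M (v, false) := by
  ext s t
  simp [compress, prodOp_apply, prod_bool_eq, withLabel, mul_comm]

/-- Expectations in a product state of the ancillas factorize over disjoint sets of ancillas. The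
supports may overlap on the qudits, which are not averaged. -/
theorem compress_mul {C D : Finset (V × Bool)} (hCD : ∀ v, (v, true) ∈ C → (v, true) ∉ D)
    {Z W : Op (V × Bool) d} (hZ : Z ∈ localOps d C) (hW : W ∈ localOps d D) :
    compress (Z * W) = compress Z * compress W := by
  induction hZ, hW using localOps_induction₂ with
  | prod M N hM hN =>
    rw [prodOp_mul, compress_prodOp, compress_prodOp, compress_prodOp, smul_mul_assoc,
      mul_smul_comm, smul_smul, prodOp_mul, ← Finset.prod_mul_distrib]
    congr 1
    refine Finset.prod_congr rfl fun v _ => ?_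
    by_cases hv : (v, true) ∈ C
    · simp [hN _ (hCD v hv)]
    · simp [hM _ hv]
  | add_left X X' Y _ _ _ h h' => simp only [compress_add, add_mul, h, h']
  | smul_left c X Y _ _ h => simp only [compress_smul, smul_mul_assoc, h]
  | add_right X Y Y' _ _ _ h h' => simp only [compress_add, mul_add, h, h']
  | smul_right c X Y _ _ h => simp only [compress_smul, mul_smul_comm, h]

theorem compress_mem {C : Finset (V × Bool)} {D : Finset V} (hCD : ∀ v, (v, false) ∈ C → v ∈ D)
    {Z : Op (V × Bool) d} (hZ : Z ∈ localOps d C) : compress Z ∈ localOps d D := by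
  induction hZ using localOps_induction with
  | prod M hM =>
    rw [compress_prodOp]
    exact Submodule.smul_mem _ _ (prodOp_mem fun v hv => hM _ fun h => hv (hCD v h))
  | add X Y _ _ h h' => rw [compress_add]; exact add_mem h h'
  | smul c X _ h => rw [compress_smul]; exact Submodule.smul_mem _ _ h

theorem dual_conjBy {W : Type*} [Fintype W] [DecidableEq W] (U X : Op W d) :
    dual (conjBy U) X = U.conjTranspose * X * U :=
  dual_eq_of_forall fun Y => by
    simp only [conjBy, LinearMap.comp_apply, LinearMap.mulLeft_apply, LinearMap.mulRight_apply]
    rw [mul_assoc, Matrix.trace_mul_comm, ← mul_assoc, Matrix.trace_mul_comm]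

theorem dual_dilation {E : Op V d →ₗ[ℂ] Op V d} {U : Op (V × Bool) d}
    (hE : ∀ ρ, E ρ = traceAncillas (conjBy U (withAncillas ρ))) (X : Op V d) :
    dual E X = compress (U.conjTranspose * lift X * U) :=
  dual_eq_of_forall fun Y => by
    rw [hE, trace_mul_traceAncillas, ← trace_dual_mul, dual_conjBy, trace_mul_withAncillas]

theorem edist_doubled (G : SimpleGraph V) (x y : V × Bool) :
    (doubled G).edist x y = G.edist x.1 y.1 + (⊤ : SimpleGraph Bool).edist x.2 y.2 :=
  SimpleGraph.edist_boxProd x y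

theorem fst_mem_of_mem_regAbar_qudits {G : SimpleGraph V} {A : Finset V} {p : V × Bool}
    (hp : p ∈ regAbar (doubled G) (qudits A)) : p.1 ∈ regAbar G A := by
  obtain ⟨⟨m, b⟩, hm, h⟩ := mem_regAbar.1 hp
  rw [edist_doubled] at h
  exact mem_regAbar.2 ⟨m, (Finset.mem_product.1 hm).1, le_self_add.trans h⟩

/-- The step from a qudit to an ancilla already costs distance 1, leaving none for a move within the
lattice. -/
theorem mem_of_ancilla_mem_regAbar_qudits {G : SimpleGraph V} {A : Finset V} {v : V}
    (hv : (v, true) ∈ regAbar (doubled G) (qudits A)) : v ∈ A := by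
  obtain ⟨⟨m, b⟩, hm, h⟩ := mem_regAbar.1 hv
  rw [edist_doubled] at h
  obtain ⟨hm, hb⟩ := Finset.mem_product.1 hm
  obtain rfl := Finset.mem_singleton.1 hb
  have h1 : (1 : ℕ∞) ≤ (⊤ : SimpleGraph Bool).edist true false := by
    rw [Order.one_le_iff_ne_zero]
    simp
  have h2 : G.edist v m = 0 := by
    by_contra h0
    have := add_le_add (Order.one_le_iff_ne_zero.2 h0) h1
    exact absurd (this.trans h) (by norm_num)
  rw [SimpleGraph.edist_eq_zero_iff] at h2
  rwa [h2]

theorem qudits_mem_regS {G : SimpleGraph V} {A : Finset V} (hA : A ∈ regS G) :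
    qudits A ∈ regS (doubled G) := by
  obtain ⟨v, hv⟩ := mem_regS.1 hA
  refine mem_regS.2 ⟨(v, false), fun p hp h => hv p.1 (Finset.mem_product.1 hp).1 ?_⟩
  rw [edist_doubled] at h
  exact le_self_add.trans h

/-- The factorization of the evolution of operators on disjoint regions, in a dilation by a
quantum cellular automaton. -/
theorem dual_dilation_mul {G : SimpleGraph V} {E : Op V d →ₗ[ℂ] Op V d} {U : Op (V × Bool) d}
    (hU : IsQCA (doubled G) U) (hE : ∀ ρ, E ρ = traceAncillas (conjBy U (withAncillas ρ)))
    {X Y : Op V d} {C D : Finset (V × Bool)} (hCD : ∀ v, (v, true) ∈ C → (v, true) ∉ D)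
    (hX : U.conjTranspose * lift X * U ∈ localOps d C)
    (hY : U.conjTranspose * lift Y * U ∈ localOps d D) :
    dual E (X * Y) = dual E X * dual E Y := by
  have hUU : U * U.conjTranspose = 1 := Matrix.mem_unitaryGroup_iff.1 hU.1
  rw [dual_dilation hE, dual_dilation hE, dual_dilation hE, ← compress_mul hCD hX hY, lift_mul]
  congr 1
  calc U.conjTranspose * (lift X * lift Y) * U
      = U.conjTranspose * lift X * 1 * lift Y * U := by simp only [mul_assoc, one_mul]
    _ = _ := by rw [← hUU]; simp only [mul_assoc]

theorem conj_lift_mem {G : SimpleGraph V} {U : Op (V × Bool) d} (hU : IsQCA (doubled G) U)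
    {A : Finset V} (hA : qudits A ∈ regS (doubled G)) {X : Op V d} (hX : X ∈ localOps d A) :
    U.conjTranspose * lift X * U ∈ localOps d (regAbar (doubled G) (qudits A)) := by
  rw [← dual_conjBy]
  exact (mem_CPQC_iff.1 hU.2).2 _ hA _ (lift_mem hX)

theorem dQC_subset_fQC (G : SimpleGraph V) : dQC G d ⊆ fQC G d := by
  rintro E ⟨hE, U, hU, hEU⟩
  refine mem_fQC_iff.2 ⟨hE, fun A hA X hX Y hY => ?_⟩
  rcases A.eq_empty_or_nonempty with rfl | hne
  · obtain ⟨c, rfl⟩ := localOps_empty hX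
    rw [dual_smul, dual_one hE.1, mul_smul_comm, dual_smul, mul_one, mul_smul_comm, mul_one]
  · refine dual_dilation_mul hU hEU (fun v h h' => ?_)
      (conj_lift_mem hU (qudits_mem_regS (regB_mem_regS hne)) hY)
      (conj_lift_mem hU (qudits_mem_regS hA) hX)
    exact Finset.disjoint_right.1 disjoint_regB (mem_of_ancilla_mem_regAbar_qudits h)
      (mem_of_ancilla_mem_regAbar_qudits h')

/-- The evolution of a product operator is the product of the evolutions of its factors. -/
theorem dual_dilation_list_prod {G : SimpleGraph V} {E : Op V d →ₗ[ℂ] Op V d}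
    {U : Op (V × Bool) d} (hch : IsChannel E) (hU : IsQCA (doubled G) U)
    (hE : ∀ ρ, E ρ = traceAncillas (conjBy U (withAncillas ρ)))
    (hS : ∀ v, qudits {v} ∈ regS (doubled G)) (X : V → Op V d) (hX : ∀ v, X v ∈ localOps d {v})
    (l : List V) (hl : l.Nodup) :
    dual E (l.map X).prod = (l.map fun v => dual E (X v)).prod := by
  -- The induction also records that the evolved product involves only the ancillas of the sites
  -- already treated; a new site then brings a new ancilla.
  suffices h : dual E (l.map X).prod = (l.map fun v => dual E (X v)).prod ∧
      ∃ C : Finset (V × Bool), (∀ v, (v, true) ∈ C → v ∈ l) ∧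
        U.conjTranspose * lift (l.map X).prod * U ∈ localOps d C from h.1
  have hUU : U.conjTranspose * U = 1 := Matrix.mem_unitaryGroup_iff'.1 hU.1
  induction l with
  | nil =>
    refine ⟨dual_one hch, ∅, by simp, ?_⟩
    rw [List.map_nil, List.prod_nil, lift_one, mul_one, hUU]
    exact one_mem_localOps _
  | cons v l ih =>
    obtain ⟨hv, hl⟩ := List.nodup_cons.1 hl
    obtain ⟨ih, C, hC, hmem⟩ := ih hl
    have hv' := conj_lift_mem hU (hS v) (hX v)
    have hanc : ∀ w, (w, true) ∈ regAbar (doubled G) (qudits {v}) → w = v := fun w hw =>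
      Finset.mem_singleton.1 (mem_of_ancilla_mem_regAbar_qudits hw)
    simp only [List.map_cons, List.prod_cons]
    refine ⟨?_, regAbar (doubled G) (qudits {v}) ∪ C, ?_, ?_⟩
    rotate_left 2
    · have := mul_mem_localOps_union hv' hmem
      have hUU' : U * U.conjTranspose = 1 := Matrix.mem_unitaryGroup_iff.1 hU.1
      have h : U.conjTranspose * lift (X v * (l.map X).prod) * U =
          (U.conjTranspose * lift (X v) * U) *
            (U.conjTranspose * lift (l.map X).prod * U) := by
        calc _ = U.conjTranspose * lift (X v) * 1 * lift (l.map X).prod * U := by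
              rw [lift_mul]; simp only [mul_assoc, one_mul]
          _ = _ := by rw [← hUU']; simp only [mul_assoc]
      rwa [← h] at this
    · rw [← ih]
      refine dual_dilation_mul hU hE (fun w hw hw' => hv ?_) hv' hmem
      rw [← hanc w hw]
      exact hC w hw'
    · intro w hw
      rcases Finset.mem_union.1 hw with hw | hw
      · simp [hanc w hw]
      · simp [hC w hw]

theorem dual_dilation_mem {G : SimpleGraph V} {E : Op V d →ₗ[ℂ] Op V d} {U : Op (V × Bool) d}
    (hU : IsQCA (doubled G) U) (hE : ∀ ρ, E ρ = traceAncillas (conjBy U (withAncillas ρ)))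
    {A : Finset V} (hA : qudits A ∈ regS (doubled G)) {X : Op V d} (hX : X ∈ localOps d A) :
    dual E X ∈ localOps d (regAbar G A) := by
  rw [dual_dilation hE]
  exact compress_mem (fun v hv => fst_mem_of_mem_regAbar_qudits hv) (conj_lift_mem hU hA hX)

/-- The Choi state of a channel with a dilation has rank at most `d ^ N`. -/
theorem rank_choi_le {E : Op V d →ₗ[ℂ] Op V d} {U : Op (V × Bool) d}
    (hE : ∀ ρ, E ρ = traceAncillas (conjBy U (withAncillas ρ))) :
    (choi E).rank ≤ d ^ Fintype.card V := by
  -- The columns are the vectorized Kraus operators, one for each of the `d ^ N` basis states of the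
  -- traced-out ancillas.
  let B : Matrix ((V → Fin d) × (V → Fin d)) (V → Fin d) ℂ :=
    Matrix.of fun p u => U (withLabel p.1 u) (withLabel p.2 fun _ => 0)
  have h : choi E = B * B.conjTranspose := by
    ext p q
    rw [choi, Matrix.of_apply, hE, traceAncillas_apply, Matrix.mul_apply]
    refine Finset.sum_congr rfl fun u _ => ?_
    simp only [conjBy, LinearMap.comp_apply, LinearMap.mulLeft_apply, LinearMap.mulRight_apply,
      Matrix.mul_apply, sum_withLabel, withAncillas_withLabel, Matrix.single_apply,
      Matrix.conjTranspose_apply]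
    rw [Finset.sum_eq_single q.2 (fun b _ hb => Finset.sum_eq_zero fun w _ => by
        simp [hb.symm]) (by simp),
      Finset.sum_eq_single (fun _ => 0) (fun w _ hw => by simp [hw]) (by simp),
      Finset.sum_eq_single p.2 (fun b _ hb => Finset.sum_eq_zero fun w _ => by
        simp [hb.symm]) (by simp),
      Finset.sum_eq_single (fun _ => 0) (fun w _ hw => by simp [hw]) (by simp)]
    simp [B]
  rw [h]
  refine (Matrix.rank_mul_le_left _ _).trans ((Matrix.rank_le_card_width _).trans ?_)
  simp

/-- Its Choi state is a multiple of the identity, of rank `d ^ (2 * N)`, too large for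
`rank_choi_le`. -/
theorem prep_maxMixed_notMem_dQC [Nonempty V] (hd : 2 ≤ d) (G : SimpleGraph V) :
    prep (maxMixed V d) ∉ dQC G d := by
  rintro ⟨_, U, _, hE⟩
  have h := rank_choi_le hE
  have hc : choi (prep (maxMixed V d)) = ((d : ℂ) ^ Fintype.card V)⁻¹ • 1 := by
    ext ⟨p, p'⟩ ⟨q, q'⟩
    rw [choi_prep]
    by_cases h1 : p = q <;> by_cases h2 : p' = q' <;> simp [maxMixed, h1, h2]
  have hN : ((d : ℂ) ^ Fintype.card V)⁻¹ ≠ 0 :=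
    inv_ne_zero (pow_ne_zero _ (Nat.cast_ne_zero.2 (NeZero.ne d)))
  rw [hc, Matrix.rank_smul_of_mem_nonZeroDivisors _ (mem_nonZeroDivisors_of_ne_zero hN), Matrix.rank_one] at h
  have h1 : 1 < d ^ Fintype.card V := Nat.one_lt_pow Fintype.card_ne_zero (by omega)
  simp only [Fintype.card_prod, Fintype.card_fun, Fintype.card_fin] at h
  nlinarith

end Dilation

/-! ### Ordered products of neighbourhood operators as tensor networks -/

section LocalProducts

variable {V : Type*} [Fintype V] [DecidableEq V] {d : ℕ}

theorem list_prod_prodOp {ι : Type*} (l : List ι) (M : ι → V → Matrix (Fin d) (Fin d) ℂ) :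
    (l.map fun i => prodOp (M i)).prod = prodOp fun w => (l.map fun i => M i w).prod := by
  induction l with
  | nil => simp [prodOp_one]
  | cons i l ih => simp only [List.map_cons, List.prod_cons, ih, prodOp_mul]

/-- The matrix unit with the given row and column. -/
def unitMat (x : Fin d × Fin d) : Matrix (Fin d) (Fin d) ℂ := Matrix.single x.1 x.2 1

open Classical in
/-- The factor at `w` of a product of matrix units on the closed neighbourhood of `v`, labelled by
`c` at `v` itself and by `m` along the edges at `v`. -/
noncomputable def starFactor (G : SimpleGraph V) (v : V) (c : Fin d × Fin d)
    (m : G.incidenceSet v → Fin d × Fin d) (w : V) : Matrix (Fin d) (Fin d) ℂ :=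
  if w = v then unitMat c
  else if h : G.Adj v w then unitMat (m ⟨s(v, w), h, Sym2.mem_mk_left v w⟩) else 1

theorem mem_regAbar_singleton {G : SimpleGraph V} {v w : V} :
    w ∈ regAbar G {v} ↔ w = v ∨ G.Adj v w := by
  rw [mem_regAbar]
  simp only [Finset.mem_singleton, exists_eq_left]
  constructor
  · intro h
    by_cases hwv : w = v
    · exact Or.inl hwv
    · right
      have : G.edist w v = 1 := le_antisymm h
        (Order.one_le_iff_ne_zero.2 fun h0 => hwv (SimpleGraph.edist_eq_zero_iff.1 h0))
      exact (SimpleGraph.edist_eq_one_iff_adj.1 this).symm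
  · rintro (rfl | h)
    · simp
    · exact (SimpleGraph.edist_eq_one_iff_adj.2 h.symm).le

/-- The neighbours of `v` correspond to the edges at `v`, so matrix units on the closed
neighbourhood can be labelled by edges, as a tensor network requires. -/
theorem exists_sum_starFactor {G : SimpleGraph V} [∀ v, Fintype (G.incidenceSet v)] {v : V}
    {K : Op V d} (hK : K ∈ localOps d (regAbar G {v})) :
    ∃ y : (Fin d × Fin d) × (G.incidenceSet v → Fin d × Fin d) → ℂ,
      ∑ x, y x • prodOp (starFactor G v x.1 x.2) = K := by
  classical
  refine (Submodule.mem_span_range_iff_exists_fun ℂ).1 ?_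
  obtain ⟨Y, rfl⟩ := mem_localOps.1 hK
  rw [Matrix.matrix_eq_sum_single Y, ← embedLin_apply]
  simp only [map_sum]
  refine Submodule.sum_mem _ fun a _ => Submodule.sum_mem _ fun b _ => ?_
  have h : Matrix.single a b (Y a b) = Y a b • Matrix.single a b (1 : ℂ) := by
    simp [Matrix.smul_single]
  rw [h, map_smul]
  refine Submodule.smul_mem _ _ (Submodule.subset_span ?_)
  have hv : v ∈ regAbar G {v} := mem_regAbar_singleton.2 (Or.inl rfl)
  have hother : ∀ e : G.incidenceSet v, ∃ w, G.Adj v w ∧ e.1 = s(v, w) := by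
    rintro ⟨e, he, hve⟩
    obtain ⟨w, rfl⟩ := hve
    exact ⟨w, he, rfl⟩
  choose o ho ho' using hother
  have hmem : ∀ e, o e ∈ regAbar G {v} := fun e => mem_regAbar_singleton.2 (Or.inr (ho e))
  refine ⟨((a ⟨v, hv⟩, b ⟨v, hv⟩), fun e => (a ⟨o e, hmem e⟩, b ⟨o e, hmem e⟩)), ?_⟩
  rw [embedLin_apply, single_eq_prodOp, embed_prodOp]
  refine congrArg prodOp (funext fun w => ?_)
  simp only [starFactor, unitMat, extendOne]
  by_cases hwv : w = v
  · subst hwv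
    simp [hv]
  · by_cases hadj : G.Adj v w
    · have hw : w ∈ regAbar G {v} := mem_regAbar_singleton.2 (Or.inr hadj)
      have how : ∀ h, (⟨o ⟨s(v, w), h⟩, hmem _⟩ : regAbar G {v}) = ⟨w, hw⟩ := fun h =>
        Subtype.ext (Sym2.congr_right.1 (ho' ⟨s(v, w), h⟩)).symm
      simp only [hwv, hadj, hw, if_false, dif_pos]
      exact congrArg (fun z => Matrix.single (a z) (b z) (1 : ℂ)) (how _)
    · have hw : w ∉ regAbar G {v} := fun h => (mem_regAbar_singleton.1 h).elim hwv hadj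
      simp only [hwv, hadj, hw, if_false, dif_neg, not_false_eq_true]

theorem list_prod_map_sum {ι A : Type*} [Fintype ι] [DecidableEq ι] [Ring A] [Algebra ℂ A]
    {α : ι → Type*} [∀ i, Fintype (α i)] (e : Fin (Fintype.card ι) ≃ ι)
    (y : ∀ i, α i → ℂ) (g : ∀ i, α i → A) :
    ((List.ofFn e).map fun i => ∑ x, y i x • g i x).prod =
      ∑ r : ∀ i, α i, (∏ i, y i (r i)) • ((List.ofFn e).map fun i => g i (r i)).prod := by
  let f := (MultilinearMap.mkPiAlgebraFin ℂ (Fintype.card ι) A).domDomCongr e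
  have hf : ∀ m : ι → A, f m = ((List.ofFn e).map m).prod := fun m => by
    simp [f, MultilinearMap.domDomCongr_apply, MultilinearMap.mkPiAlgebraFin_apply,
      List.map_ofFn, Function.comp_def]
  rw [← hf, MultilinearMap.map_sum]
  refine Finset.sum_congr rfl fun r _ => ?_
  rw [MultilinearMap.map_smul_univ, hf]

theorem card_mem_edge {G : SimpleGraph V} (e : G.edgeSet) [Fintype {v // v ∈ e.1}] :
    Fintype.card {v // v ∈ e.1} = 2 := by
  rw [← Sym2.card_toFinset_of_not_isDiag e.1 (G.not_isDiag_of_mem_edgeSet e.2)]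
  exact Fintype.card_of_subtype _ fun v => Sym2.mem_toFinset

open Classical in
/-- An ordered product of operators on the closed neighbourhoods of all the vertices, each
depending on labels of its vertex only, has matrix elements given by a tensor network. -/
theorem isPEPO_list_prod {G : SimpleGraph V} (e : Fin (Fintype.card V) ≃ V)
    (K : V → Fin d → Fin d → Op V d) (hK : ∀ v i j, K v i j ∈ localOps d (regAbar G {v})) :
    IsPEPO G (d ^ 4) (Matrix.of fun p q =>
      ((List.ofFn e).map fun v => K v (q.1 v) (p.1 v)).prod q.2 p.2) := by
  choose y hy using fun v i j => exists_sum_starFactor (hK v i j)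
  -- An edge value encodes two matrix units, one for each endpoint: the label stored at endpoint `v`
  -- is the factor that the operator `K v` places on the other endpoint. Hence `(d ^ 2) ^ 2` values.
  have hcard : ∀ x : G.edgeSet,
      Fintype.card ({v // v ∈ x.1} → Fin d × Fin d) = Fintype.card (Fin (d ^ 4)) := fun x => by
    rw [Fintype.card_fun, card_mem_edge]
    simp only [Fintype.card_prod, Fintype.card_fin]
    ring
  let dec : ∀ x : G.edgeSet, Fin (d ^ 4) ≃ ({v // v ∈ x.1} → Fin d × Fin d) :=
    fun x => (Fintype.equivOfCardEq (hcard x)).symm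
  let Ψ : (G.edgeSet → Fin (d ^ 4)) ≃ (∀ v, G.incidenceSet v → Fin d × Fin d) :=
    (Equiv.piCongrRight dec).trans
      { toFun := fun f v x => f ⟨x, x.2.1⟩ ⟨v, x.2.2⟩
        invFun := fun g x v => g v ⟨x, x.2, v.2⟩
        left_inv := fun _ => rfl
        right_inv := fun _ => rfl }
  -- The factor at `w` of the operator centred at `v`, read from the edges at `w` only. It is
  -- `starFactor` seen from the receiving site.
  let W : (w : V) → (G.incidenceSet w → Fin (d ^ 4)) → Fin d × Fin d → V →
      Matrix (Fin d) (Fin d) ℂ := fun w η c v =>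
    if w = v then unitMat c
    else if h : G.Adj v w then
      unitMat (dec ⟨s(v, w), h⟩ (η ⟨s(v, w), h, Sym2.mem_mk_right v w⟩) ⟨v, Sym2.mem_mk_left v w⟩)
    else 1
  refine ⟨fun w η => Matrix.of fun a b => ∑ c : Fin d × Fin d,
    y w b.1 a.1 (c, fun x => dec ⟨x, x.2.1⟩ (η x) ⟨w, x.2.2⟩) *
      ((List.ofFn e).map fun v => W w η c v).prod b.2 a.2, fun p q => ?_⟩
  simp only [Matrix.of_apply]
  simp only [← hy]
  rw [list_prod_map_sum]
  simp only [Matrix.sum_apply, Matrix.smul_apply, list_prod_prodOp, prodOp_apply, smul_eq_mul,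
    ← Finset.prod_mul_distrib]
  let Φ : (∀ v, (Fin d × Fin d) × (G.incidenceSet v → Fin d × Fin d)) ≃
      (∀ v, G.incidenceSet v → Fin d × Fin d) × (V → Fin d × Fin d) :=
    { toFun := fun r => (fun v => (r v).2, fun v => (r v).1)
      invFun := fun s v => (s.2 v, s.1 v)
      left_inv := fun _ => rfl
      right_inv := fun _ => rfl }
  rw [← Equiv.sum_comp Φ.symm, Fintype.sum_prod_type, ← Equiv.sum_comp Ψ]
  refine Finset.sum_congr rfl fun x _ => ?_
  rw [Finset.prod_univ_sum, Fintype.piFinset_univ]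
  refine Finset.sum_congr rfl fun c _ => Finset.prod_congr rfl fun w _ => ?_
  congr 1
  have hW : ∀ v, starFactor G v (c v) (Ψ x v) w =
      W w (fun z => x ⟨z, G.incidenceSet_subset w z.2⟩) (c w) v := by
    intro v
    simp only [starFactor, W]
    split_ifs with h1 h2
    · rw [h1]
    · rfl
    · rfl
  exact congrArg (fun l : List (Matrix (Fin d) (Fin d) ℂ) => l.prod (q.2 w) (p.2 w))
    (List.map_congr_left fun v _ => hW v)

theorem choi_eq_dual (E : Op V d →ₗ[ℂ] Op V d) (p q : (V → Fin d) × (V → Fin d)) :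
    choi E p q = dual E (Matrix.single q.1 p.1 1) q.2 p.2 := by
  rw [choi, Matrix.of_apply, ← trace_single_mul q.1 p.1 (E _), ← trace_dual_mul,
    Matrix.trace_mul_comm, trace_single_mul]

theorem list_prod_map_ite {A : Type*} [Monoid A] (w : V) (f : V → A) (l : List V) (hl : l.Nodup) :
    (l.map fun v => if w = v then f v else 1).prod = if w ∈ l then f w else 1 := by
  induction l with
  | nil => simp
  | cons v l ih =>
    obtain ⟨hv, hl⟩ := List.nodup_cons.1 hl
    rw [List.map_cons, List.prod_cons, ih hl]
    by_cases hwv : w = v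
    · subst hwv
      simp [hv]
    · simp [hwv]

theorem single_eq_list_prod (e : Fin (Fintype.card V) ≃ V) (a b : V → Fin d) :
    Matrix.single a b (1 : ℂ) = ((List.ofFn e).map fun v =>
      prodOp fun w => if w = v then Matrix.single (a v) (b v) (1 : ℂ) else 1).prod := by
  rw [single_eq_prodOp, list_prod_prodOp]
  refine congrArg prodOp (funext fun w => ?_)
  rw [list_prod_map_ite w (fun v => Matrix.single (a v) (b v) (1 : ℂ)) _
    (List.nodup_ofFn.2 e.injective), if_pos (List.mem_ofFn.2 ⟨e.symm w, e.apply_symm_apply w⟩)]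

/-- Entries of the Choi state are entries of the duals of matrix units. A matrix unit is a product
of one-site ones, and the dual respects this product although neighbouring factors overlap after
evolution. -/
theorem isPEPO_choi_of_dilation [NeZero d] {G : SimpleGraph V} {E : Op V d →ₗ[ℂ] Op V d}
    {U : Op (V × Bool) d} (hch : IsChannel E) (hU : IsQCA (doubled G) U)
    (hE : ∀ ρ, E ρ = traceAncillas (conjBy U (withAncillas ρ)))
    (hS : ∀ v, qudits {v} ∈ regS (doubled G)) : IsPEPO G (d ^ 4) (choi E) := by
  let e := (Fintype.equivFin V).symm
  let X : V → Fin d → Fin d → Op V d := fun v i j =>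
    prodOp fun w => if w = v then Matrix.single i j (1 : ℂ) else 1
  have hX : ∀ v i j, X v i j ∈ localOps d {v} := fun v i j => prodOp_mem fun w hw => by
    rw [Finset.mem_singleton] at hw
    simp [hw]
  have h : choi E = Matrix.of fun p q =>
      ((List.ofFn e).map fun v => dual E (X v (q.1 v) (p.1 v))).prod q.2 p.2 := by
    ext p q
    rw [choi_eq_dual, single_eq_list_prod e, Matrix.of_apply,
      ← dual_dilation_list_prod hch hU hE hS (fun v => X v (q.1 v) (p.1 v)) (fun v => hX v _ _)
        (List.ofFn e) (List.nodup_ofFn.2 e.injective)]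
  rw [h]
  exact isPEPO_list_prod e (fun v i j => dual E (X v i j)) fun v i j =>
    dual_dilation_mem hU hE (hS v) (hX v i j)

theorem dQC_subset_tnQC [NeZero d] {G : SimpleGraph V} (hS : ∀ v, qudits {v} ∈ regS (doubled G))
    {D : ℕ} (hD : d ^ 4 ≤ D) : dQC G d ⊆ tnQC G d D := by
  rintro E ⟨hE, U, hU, hEU⟩
  exact ⟨hE, d ^ 4, hD, isPEPO_choi_of_dilation hE.1 hU hEU hS⟩

end LocalProducts

/-! ### Distances in the lattice -/

section Geometry

theorem eq_of_preconnected {V α : Type*} {G : SimpleGraph V} (hG : G.Preconnected) (f : V → α)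
    (hf : ∀ v w, G.Adj v w → f v = f w) (v w : V) : f v = f w := by
  obtain ⟨W⟩ := hG v w
  induction W with
  | nil => rfl
  | cons h _ ih => rw [hf _ _ h, ih]

/-- Otherwise no edge could leave `A`, since a neighbour of `A` is too close to be in `B`;
connectedness would then force `A` to be everything. -/
theorem exists_notMem_union_regB {V : Type*} [Fintype V] [DecidableEq V] {G : SimpleGraph V}
    (hG : G.Preconnected) {A : Finset V} (hA : A.Nonempty) (hS : A ∈ regS G) :
    ∃ v, v ∉ A ∪ regB G A := by
  by_contra! h
  obtain ⟨a, ha⟩ := hA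
  obtain ⟨b, hb⟩ : (regB G A).Nonempty := hS
  have hadj : ∀ v w, G.Adj v w → v ∈ A → w ∈ A := fun v w hvw hv => by
    refine (Finset.mem_union.1 (h w)).resolve_right fun hw => mem_regB.1 hw v hv ?_
    rw [SimpleGraph.edist_eq_one_iff_adj.2 hvw.symm]
    norm_num
  have := eq_of_preconnected hG (· ∈ A)
    (fun v w hvw => propext ⟨hadj v w hvw, hadj w v hvw.symm⟩) a b
  exact Finset.disjoint_right.1 disjoint_regB hb (this ▸ ha)

theorem le_add_of_edist_le {V : Type*} {G : SimpleGraph V} {φ : V → ℕ}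
    (hφ : ∀ v w, G.Adj v w → φ w ≤ φ v + 1) {v w : V} {r : ℕ} (h : G.edist v w ≤ r) :
    φ w ≤ φ v + r := by
  obtain ⟨W, hW⟩ := SimpleGraph.exists_walk_of_edist_ne_top
    (ne_top_of_le_ne_top (ENat.natCast_ne_top r) h)
  rw [← hW, Nat.cast_le] at h
  refine le_trans ?_ (Nat.add_le_add_left h _)
  clear hW h
  induction W with
  | nil => simp
  | cons h _ ih =>
    have := hφ _ _ h
    rw [SimpleGraph.Walk.length_cons]
    omega

theorem line_adj {bc : Boundary} {M : ℕ} {i j : Fin M} (h : (line bc M).Adj i j) :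
    i.val + 1 = j.val ∨ j.val + 1 = i.val ∨ bc = .periodic ∧
      (i.val = 0 ∧ j.val + 1 = M ∨ j.val = 0 ∧ i.val + 1 = M) := by
  cases bc with
  | opn =>
    rcases SimpleGraph.pathGraph_adj.1 h with h | h <;> omega
  | periodic =>
    have h' : (i - j).val = 1 ∨ (j - i).val = 1 := SimpleGraph.cycleGraph_adj'.1 h
    have key : ∀ i j : Fin M, (i - j).val = 1 →
        j.val + 1 = i.val ∨ i.val = 0 ∧ j.val + 1 = M := by
      intro i j hij
      rcases le_or_gt j i with hle | hlt
      · rw [Fin.coe_sub_iff_le.2 hle] at hij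
        omega
      · rw [Fin.coe_sub_iff_lt.2 hlt] at hij
        omega
    rcases h' with h' | h'
    · have := key _ _ h'; tauto
    · have := key _ _ h'; tauto

theorem line_preconnected (bc : Boundary) (M : ℕ) : (line bc M).Preconnected := by
  cases bc with
  | opn => exact SimpleGraph.pathGraph_preconnected M
  | periodic => exact SimpleGraph.cycleGraph_preconnected

theorem lattice_preconnected (bc : Boundary) (dL M : ℕ) : (lattice bc dL M).Preconnected := by
  have h1 : ∀ (n : Site dL M) (i : Fin dL) (a b : Fin M),
      (lattice bc dL M).Reachable (Function.update n i a) (Function.update n i b) := by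
    intro n i a b
    obtain ⟨W⟩ := line_preconnected bc M a b
    induction W with
    | nil => exact SimpleGraph.Reachable.refl _
    | cons h _ ih =>
      refine SimpleGraph.Reachable.trans (SimpleGraph.Adj.reachable ?_) ih
      exact ⟨i, by simpa using h, fun j hj => by simp [hj]⟩
  intro n m
  suffices h : ∀ s : Finset (Fin dL), (lattice bc dL M).Reachable n (s.piecewise m n) by
    simpa using h Finset.univ
  intro s
  induction s using Finset.induction_on with
  | empty => simp
  | insert i s hi ih =>
    refine ih.trans ?_
    rw [Finset.piecewise_insert]
    have := h1 (s.piecewise m n) i (s.piecewise m n i) (m i)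
    rwa [Function.update_eq_self] at this

/-- The ancilla of a site two steps away is at distance at least 3, the third step being the one to
the ancilla. So one-site observables evolve locally in the doubled lattice even on the short
periodic chains, where no site of the original lattice is that far. -/
theorem qudits_singleton_mem_regS (bc : Boundary) {dL M : ℕ} (hdL : 1 ≤ dL) (hM : 4 ≤ M)
    (n : Site dL M) : qudits {n} ∈ regS (doubled (lattice bc dL M)) := by
  let i : Fin dL := ⟨0, hdL⟩
  obtain ⟨j, hj⟩ : ∃ j : Fin M, (n i).val + 2 = j.val ∨ j.val + 2 = (n i).val := by
    by_cases h : (n i).val + 2 < M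
    · exact ⟨⟨_, h⟩, Or.inl rfl⟩
    · exact ⟨⟨(n i).val - 2, by omega⟩, Or.inr (by simp only; omega)⟩
  let m := Function.update n i j
  have hm : m i = j := by simp [m]
  have hne : m ≠ n := fun h => by
    rw [h] at hm
    rw [hm] at hj
    omega
  have hadj : ¬ (lattice bc dL M).Adj m n := by
    rintro ⟨k, hk, hk'⟩
    have hki : k = i := by
      by_contra hki
      have := hk' i (Ne.symm hki)
      rw [hm] at this
      rw [this] at hj
      omega
    rw [hki, hm] at hk
    have := (n i).isLt
    have := line_adj hk
    omega
  refine mem_regS.2 ⟨(m, true), fun p hp h => ?_⟩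
  obtain ⟨hp1, hp2⟩ := Finset.mem_product.1 hp
  rw [edist_doubled, Finset.mem_singleton.1 hp1, Finset.mem_singleton.1 hp2] at h
  have h1 : (1 : ℕ∞) ≤ (⊤ : SimpleGraph Bool).edist true false :=
    Order.one_le_iff_ne_zero.2 (by simp)
  have h2 : (1 : ℕ∞) < (lattice bc dL M).edist m n := by
    refine lt_of_le_of_ne (Order.one_le_iff_ne_zero.2 fun h0 =>
      hne (SimpleGraph.edist_eq_zero_iff.1 h0)) fun h0 => hadj ?_
    exact SimpleGraph.edist_eq_one_iff_adj.1 h0.symm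
  have h3 := add_le_add (Order.add_one_le_of_lt h2) h1
  exact absurd (h3.trans h) (by norm_num)

/-- The distance of a point of the line from its first point. -/
def lineHeight (bc : Boundary) (M : ℕ) (i : Fin M) : ℕ :=
  match bc with
  | .opn => i
  | .periodic => min i (M - i)

theorem lineHeight_le {bc : Boundary} {M : ℕ} {i j : Fin M} (h : (line bc M).Adj i j) :
    lineHeight bc M j ≤ lineHeight bc M i + 1 := by
  have := line_adj h
  cases bc <;> simp only [lineHeight] <;> simp at this <;> omega

/-- The sum of the coordinate heights changes by at most 1 along an edge, so it bounds distances
from the origin from below. -/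
theorem exists_far_sites {bc : Boundary} {dL M : ℕ} (hdL : 1 ≤ dL) (hM : 4 ≤ M)
    (h : ¬ (bc = .periodic ∧ dL = 1 ∧ M ≤ 5)) :
    ∃ n m : Site dL M, ¬ (lattice bc dL M).edist m n ≤ 2 := by
  let φ : Site dL M → ℕ := fun n => ∑ i, lineHeight bc M (n i)
  have hφ : ∀ n m, (lattice bc dL M).Adj n m → φ m ≤ φ n + 1 := by
    rintro n m ⟨i, hi, hi'⟩
    simp only [φ]
    rw [← Finset.add_sum_erase _ _ (Finset.mem_univ i),
      ← Finset.add_sum_erase _ (fun i => lineHeight bc M (n i)) (Finset.mem_univ i),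
      Finset.sum_congr rfl fun j hj => by rw [← hi' j (Finset.ne_of_mem_erase hj)]]
    have := lineHeight_le hi
    omega
  -- An open line has height `M - 1 ≥ 3`. A cycle has only `M / 2 ≥ 2`, which suffices in two or
  -- more dimensions, and in one dimension from `M = 6` on.
  obtain ⟨j, hj⟩ : ∃ j : Fin M, 3 ≤ dL * lineHeight bc M j := by
    cases bc with
    | opn =>
      refine ⟨⟨M - 1, by omega⟩, ?_⟩
      simp only [lineHeight]
      nlinarith [show 3 ≤ M - 1 by omega]
    | periodic =>
      refine ⟨⟨M / 2, by omega⟩, ?_⟩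
      have h2 : M / 2 ≤ M - M / 2 := by omega
      simp only [lineHeight, min_eq_left h2]
      rcases Nat.lt_or_ge 1 dL with h1 | h1
      · nlinarith [show 2 ≤ M / 2 by omega]
      · have : dL = 1 := by omega
        subst this
        simp at h
        omega
  refine ⟨fun _ => j, fun _ => ⟨0, by omega⟩, fun hle => ?_⟩
  have := le_add_of_edist_le (r := 2) hφ (by exact_mod_cast hle)
  have h0 : lineHeight bc M ⟨0, by omega⟩ = 0 := by cases bc <;> simp [lineHeight]
  simp only [φ, h0, Finset.sum_const, Finset.card_univ, Fintype.card_fin, smul_eq_mul,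
    mul_zero] at this
  omega

end Geometry

/-! ### Rank across a cut, and a channel with a volume law -/

section VolumeLaw

theorem exists_pos_posSemidef_one_add {n : Type*} [Fintype n] [DecidableEq n] {H : Matrix n n ℂ}
    (hH : H.IsHermitian) : ∃ ε : ℝ, 0 < ε ∧ (1 + (ε : ℂ) • H).PosSemidef := by
  open scoped MatrixOrder Matrix.Norms.L2Operator in
  have h0 : 0 < ‖H‖ + 1 := by positivity
  have h1 : (H - -algebraMap ℝ (Matrix n n ℂ) ‖H‖).PosSemidef :=
    Matrix.le_iff.1 (IsSelfAdjoint.neg_algebraMap_norm_le_self (a := H) hH)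
  -- With this choice `1 + ε H` is the positive operator `1 + (H + ‖H‖)` rescaled by `ε`.
  refine ⟨(‖H‖ + 1)⁻¹, inv_pos.2 h0, ?_⟩
  have h2 : (0 : ℂ) ≤ (((‖H‖ + 1)⁻¹ : ℝ) : ℂ) := by
    exact_mod_cast (inv_pos.2 h0).le
  have h3 := (Matrix.PosSemidef.one.add h1).smul h2
  convert h3 using 1
  have h4 : (((‖H‖ + 1)⁻¹ : ℝ) : ℂ) * ((‖H‖ : ℂ) + 1) = 1 := by
    rw [← Complex.ofReal_one, ← Complex.ofReal_add, ← Complex.ofReal_mul, inv_mul_cancel₀ h0.ne']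
  rw [sub_neg_eq_add, Algebra.algebraMap_eq_smul_one, smul_add, smul_add]
  rw [← Complex.coe_smul ‖H‖ (1 : Matrix n n ℂ), smul_smul, add_left_comm, ← add_smul]
  rw [← mul_one_add, add_comm (1 : ℂ), h4, one_smul, add_comm]

variable {V : Type*} [Fintype V] [DecidableEq V] {d : ℕ}

theorem trace_mul_prodOp_eq_zero {C : Finset V} {X : Op V d} (hX : X ∈ localOps d C) {v : V}
    (hv : v ∉ C) {M : V → Matrix (Fin d) (Fin d) ℂ} (hM : (M v).trace = 0) :
    (X * prodOp M).trace = 0 := by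
  induction hX using localOps_induction with
  | prod N hN =>
    rw [prodOp_mul, trace_prodOp]
    exact Finset.prod_eq_zero (Finset.mem_univ v) (by rw [hN v hv, one_mul, hM])
  | add X Y _ _ h h' => rw [add_mul, Matrix.trace_add, h, h', add_zero]
  | smul c X _ h => rw [smul_mul_assoc, Matrix.trace_smul, h, smul_zero]

/-- A perturbation of the maximally mixed state that is invisible on all proper subsystems. -/
noncomputable def perturbed (ε : ℝ) (W : Op V d) : Op V d :=
  ((d : ℂ) ^ Fintype.card V)⁻¹ • (1 + (ε : ℂ) • W)

/-- For nonempty `A` the region `A ∪ B` misses a site, so its observables cannot tell this state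
from the maximally mixed one, which has no correlations. -/
theorem prep_perturbed_mem_fQC [NeZero d] [Nonempty V] {G : SimpleGraph V} (hG : G.Preconnected)
    {ε : ℝ} {W : Op V d} (hpos : (1 + (ε : ℂ) • W).PosSemidef)
    (hW : ∀ (C : Finset V), (∃ v, v ∉ C) → ∀ X ∈ localOps d C, (X * W).trace = 0) :
    prep (perturbed ε W) ∈ fQC G d := by
  have hN : (d : ℂ) ^ Fintype.card V ≠ 0 := pow_ne_zero _ (Nat.cast_ne_zero.2 (NeZero.ne d))
  have htr : ∀ (C : Finset V), (∃ v, v ∉ C) → ∀ X ∈ localOps d C,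
      (X * perturbed ε W).trace = ((d : ℂ) ^ Fintype.card V)⁻¹ * X.trace := fun C hC X hX => by
    rw [perturbed, mul_smul_comm, mul_add, mul_one, mul_smul_comm, Matrix.trace_smul,
      Matrix.trace_add, Matrix.trace_smul, hW C hC X hX, smul_zero, add_zero, smul_eq_mul]
  have htr1 : (perturbed ε W).trace = 1 := by
    have := htr ∅ ⟨Classical.arbitrary V, by simp⟩ 1 (one_mem_localOps _)
    rwa [one_mul, trace_one_op, inv_mul_cancel₀ hN] at this
  have hps : (perturbed ε W).PosSemidef := by
    refine hpos.smul ?_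
    rw [← Nat.cast_pow]
    exact inv_nonneg.2 (Nat.cast_nonneg _)
  rw [prep_mem_fQC_iff hps htr1]
  intro A hA X hX Y hY
  rcases A.eq_empty_or_nonempty with rfl | hne
  · obtain ⟨c, rfl⟩ := localOps_empty hX
    rw [mul_smul_comm, mul_one, smul_mul_assoc, smul_mul_assoc, one_mul, Matrix.trace_smul,
      Matrix.trace_smul, htr1, smul_eq_mul, smul_eq_mul, mul_one, mul_comm]
  · obtain ⟨v, hv⟩ := exists_notMem_union_regB hG hne hA
    have hv' := hv
    rw [Finset.mem_union, not_or] at hv'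
    rw [htr _ ⟨v, hv'.1⟩ X hX, htr _ ⟨v, hv'.2⟩ Y hY,
      htr _ ⟨v, by rwa [Finset.union_comm] at hv⟩ _ (mul_mem_localOps_union hY hX)]
    have h := trace_mul_of_disjoint disjoint_regB.symm hY hX
    field_simp
    rw [← h]

/-- Contraction of two families of functions of variables `ι → Q`, along the variables
that both depend on. -/
theorem rank_sum_mul_le {ι Q I J : Type*} [Fintype ι] [DecidableEq ι] [Fintype Q] [Fintype I]
    [Fintype J] (S T : ι → Prop) [DecidablePred S] [DecidablePred T]
    (F : I → (ι → Q) → ℂ) (H : J → (ι → Q) → ℂ)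
    (hF : ∀ i e e', (∀ x, S x → e x = e' x) → F i e = F i e')
    (hH : ∀ j e e', (∀ x, T x → e x = e' x) → H j e = H j e') :
    (Matrix.of fun i j => ∑ e, F i e * H j e).rank ≤
      Fintype.card Q ^ Fintype.card {x // S x ∧ T x} := by
  classical
  rcases isEmpty_or_nonempty (ι → Q) with hempty | ⟨⟨e₀⟩⟩
  · have h : (Matrix.of fun i j => ∑ e, F i e * H j e) = 0 := by
      ext i j
      simp
    rw [h, Matrix.rank_zero]
    exact Nat.zero_le _
  let merge : ({x // S x ∧ T x} → Q) → ({x // S x ∧ ¬ T x} → Q) → ({x // ¬ S x} → Q) → ι → Q :=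
    fun c a b x => if hs : S x then if ht : T x then c ⟨x, hs, ht⟩ else a ⟨x, hs, ht⟩ else b ⟨x, hs⟩
  let Φ : (({x // S x ∧ T x} → Q) × ({x // S x ∧ ¬ T x} → Q) × ({x // ¬ S x} → Q)) ≃ (ι → Q) :=
    { toFun := fun y => merge y.1 y.2.1 y.2.2
      invFun := fun e => (fun x => e x, fun x => e x, fun x => e x)
      left_inv := by
        rintro ⟨c, a, b⟩
        refine Prod.ext (funext fun x => ?_) (Prod.ext (funext fun x => ?_) (funext fun x => ?_))
        · simp [merge, x.2.1, x.2.2]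
        · simp [merge, x.2.1, x.2.2]
        · simp [merge, x.2]
      right_inv := by
        intro e
        funext x
        simp only [merge]
        split_ifs <;> rfl }
  -- For fixed shared variables, each factor is summed over its private ones; those in neither `S`
  -- nor `T` are summed with `H`. The values of `e₀` only fill positions on which the factor does
  -- not depend.
  let F' : Matrix I ({x // S x ∧ T x} → Q) ℂ :=
    Matrix.of fun i c => ∑ a, F i (merge c a fun x => e₀ x)
  let H' : Matrix ({x // S x ∧ T x} → Q) J ℂ :=
    Matrix.of fun c j => ∑ b, H j (merge c (fun x => e₀ x) b)
  have h : (Matrix.of fun i j => ∑ e, F i e * H j e) = F' * H' := by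
    ext i j
    rw [Matrix.mul_apply, Matrix.of_apply, ← Equiv.sum_comp Φ, Fintype.sum_prod_type]
    refine Finset.sum_congr rfl fun c _ => ?_
    rw [Fintype.sum_prod_type]
    simp only [F', H', Matrix.of_apply, Finset.sum_mul_sum]
    refine Finset.sum_congr rfl fun a _ => Finset.sum_congr rfl fun b _ => ?_
    congr 1
    · exact hF i _ _ fun x hx => by simp [Φ, merge, hx]
    · exact hH j _ _ fun x hx => by simp [Φ, merge, hx]
  rw [h]
  refine (Matrix.rank_mul_le_left _ _).trans ((Matrix.rank_le_card_width _).trans ?_)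
  rw [Fintype.card_fun]

open Classical in
/-- The edges between `L` and its complement. -/
abbrev CutEdge (G : SimpleGraph V) (L : Finset V) : Type _ :=
  {e : G.edgeSet // (∃ v ∈ e.1, v ∈ L) ∧ ∃ v ∈ e.1, v ∉ L}

open Classical in
/-- The rank of a PEPO across a bipartition is bounded by the number of cut edges. -/
theorem rank_le_of_isPEPO {G : SimpleGraph V} {D : ℕ}
    {R : Matrix ((V → Fin d) × (V → Fin d)) ((V → Fin d) × (V → Fin d)) ℂ} (hR : IsPEPO G D R)
    (L : Finset V) {I : Type*} [Fintype I] (f : I → V → Fin d) (p : (V → Fin d) × (V → Fin d))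
    (u : V → Fin d) :
    (Matrix.of fun i j : I => R p (fun v => if v ∈ L then f i v else f j v, u)).rank ≤
      D ^ Fintype.card (CutEdge G L) := by
  obtain ⟨T, hT⟩ := hR
  let t : I → (G.edgeSet → Fin D) → V → ℂ := fun i e v =>
    T v (fun x => e ⟨x, G.incidenceSet_subset v x.2⟩) (p.1 v, p.2 v) (f i v, u v)
  have ht : ∀ i e e' v, (∀ x : G.edgeSet, v ∈ x.1 → e x = e' x) → t i e v = t i e' v := by
    intro i e e' v h
    simp only [t]
    congr 1
    funext x
    rw [h ⟨x, G.incidenceSet_subset v x.2⟩ x.2.2]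
  have h := rank_sum_mul_le (Q := Fin D) (fun e : G.edgeSet => ∃ v ∈ e.1, v ∈ L)
    (fun e : G.edgeSet => ∃ v ∈ e.1, v ∉ L)
    (fun i e => ∏ v ∈ L, t i e v) (fun j e => ∏ v ∈ Lᶜ, t j e v)
    (fun i e e' h => Finset.prod_congr rfl fun v hv => ht i e e' v fun x hx => h x ⟨v, hx, hv⟩)
    (fun j e e' h => Finset.prod_congr rfl fun v hv => ht j e e' v fun x hx =>
      h x ⟨v, hx, Finset.mem_compl.1 hv⟩)
  rw [Fintype.card_fin] at h
  convert h using 2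
  ext i j
  rw [Matrix.of_apply, Matrix.of_apply, hT]
  refine Finset.sum_congr rfl fun e _ => ?_
  rw [← Finset.prod_mul_prod_compl L]
  congr 1
  · exact Finset.prod_congr rfl fun v hv => by simp [t, hv]
  · exact Finset.prod_congr rfl fun v hv => by simp [t, Finset.mem_compl.1 hv]

/-- Two linearly independent traceless Hermitian matrices. -/
def pauli (x y : Fin d) (b : Bool) : Matrix (Fin d) (Fin d) ℂ :=
  if b then Matrix.single x y 1 + Matrix.single y x 1 else Matrix.single x x 1 - Matrix.single y y 1

theorem trace_pauli {x y : Fin d} (hxy : x ≠ y) (b : Bool) : (pauli x y b).trace = 0 := by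
  cases b <;> simp [pauli, Matrix.trace_single_eq_of_ne, hxy, hxy.symm]

theorem conjTranspose_pauli (x y : Fin d) (b : Bool) :
    (pauli x y b).conjTranspose = pauli x y b := by
  cases b <;> simp [pauli, Matrix.conjTranspose_single, add_comm]

theorem pauli_apply {x y : Fin d} (hxy : x ≠ y) (b c : Bool) :
    pauli x y b x (if c then y else x) = if b = c then 1 else 0 := by
  cases b <;> cases c <;> simp [pauli, hxy, hxy.symm]

/-- The sum of all tensor products of `pauli` matrices whose labels factor through `π`. -/
noncomputable def pauliSum {K : Type*} [Fintype K] [DecidableEq K] (x y : Fin d) (π : V → K) :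
    Op V d :=
  ∑ l : K → Bool, prodOp fun v => pauli x y (l (π v))

-- In the row of the constant label `x`, each `pauli` matrix has a single nonzero entry, whose
-- column reveals its label. `pauliSum` therefore compares the labels read inside and outside `L`:
-- each `k` is visible on both sides, so the matrix across the cut is diagonal, with `2 ^ |K|`
-- nonzero entries.
open Classical in
theorem exists_fQC_volumeLaw [Nonempty V] {G : SimpleGraph V} (hG : G.Preconnected) (hd : 2 ≤ d)
    {K : Type*} [Fintype K] (π : V → K) (L : Finset V)
    (hL : ∀ k, ∃ v ∈ L, π v = k) (hL' : ∀ k, ∃ v, v ∉ L ∧ π v = k) :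
    ∃ E ∈ fQC G d, ∀ D, IsPEPO G D (choi E) →
      2 ^ Fintype.card K ≤ D ^ Fintype.card (CutEdge G L) := by
  have : NeZero d := ⟨by omega⟩
  let x : Fin d := ⟨0, by omega⟩
  let y : Fin d := ⟨1, by omega⟩
  have hxy : x ≠ y := by simp [x, y]
  have hN : (d : ℂ) ^ Fintype.card V ≠ 0 := pow_ne_zero _ (Nat.cast_ne_zero.2 (NeZero.ne d))
  have hH : (pauliSum x y π).IsHermitian := by
    rw [Matrix.IsHermitian, pauliSum, Matrix.conjTranspose_sum]
    simp only [conjTranspose_prodOp, conjTranspose_pauli]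
  obtain ⟨ε, hε, hpos⟩ := exists_pos_posSemidef_one_add hH
  refine ⟨prep (perturbed ε (pauliSum x y π)), prep_perturbed_mem_fQC hG hpos ?_, fun D hD => ?_⟩
  · rintro C ⟨v, hv⟩ X hX
    rw [pauliSum, Matrix.mul_sum, Matrix.trace_sum]
    exact Finset.sum_eq_zero fun l _ => trace_mul_prodOp_eq_zero hX hv (trace_pauli hxy _)
  have hrank := rank_le_of_isPEPO hD L (fun (l : K → Bool) v => if l (π v) then y else x)
    (fun _ => x, fun _ => x) (fun _ => x)
  have hlabel : ∀ l l' m : K → Bool,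
      (∀ v, m (π v) = if v ∈ L then l (π v) else l' (π v)) ↔ m = l ∧ m = l' := by
    intro l l' m
    constructor
    · intro h
      constructor
      · funext k
        obtain ⟨v, hv, rfl⟩ := hL k
        simpa [hv] using h v
      · funext k
        obtain ⟨v, hv, rfl⟩ := hL' k
        simpa [hv] using h v
    · rintro ⟨rfl, rfl⟩ v
      simp
  have hdiag : (Matrix.of fun l l' : K → Bool => choi (prep (perturbed ε (pauliSum x y π)))
      (fun _ => x, fun _ => x)
      (fun v => if v ∈ L then if l (π v) then y else x else if l' (π v) then y else x,
        fun _ => x)) =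
      -- The identity contributes only where both labels are constantly `false`, and there it adds 1
      -- to the positive `ε`, so no diagonal entry vanishes.
      Matrix.diagonal fun l => ((d : ℂ) ^ Fintype.card V)⁻¹ *
        ((if (fun _ => false) = l then 1 else 0) + ε) := by
    ext l l'
    have hmix : (fun v => if v ∈ L then if l (π v) then y else x else if l' (π v) then y else x) =
        fun v => if (if v ∈ L then l (π v) else l' (π v)) then y else x := by
      funext v
      split_ifs <;> simp_all
    have hsum : pauliSum x y π (fun _ => x)
        (fun v => if (if v ∈ L then l (π v) else l' (π v)) then y else x) =
        if l = l' then 1 else 0 := by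
      simp only [pauliSum, Matrix.sum_apply, prodOp_apply, pauli_apply hxy, Finset.prod_ite_zero,
        Finset.prod_const_one, Finset.mem_univ, true_implies, hlabel]
      by_cases h : l = l'
      · subst h; simp
      · rw [if_neg h]
        exact Finset.sum_eq_zero fun m _ => if_neg fun hm => h (hm.1.symm.trans hm.2)
    have hone : (1 : Op V d) (fun _ => x)
        (fun v => if (if v ∈ L then l (π v) else l' (π v)) then y else x) =
        if (fun _ => false) = l ∧ (fun _ => false) = l' then 1 else 0 := by
      rw [Matrix.one_apply]
      refine if_congr ?_ rfl rfl
      rw [← hlabel, funext_iff]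
      refine forall_congr' fun v => ?_
      cases (if v ∈ L then l (π v) else l' (π v)) <;> simp [hxy]
    rw [Matrix.of_apply, hmix, choi_prep, if_pos rfl, perturbed, Matrix.smul_apply,
      Matrix.add_apply, Matrix.smul_apply, hsum, hone, Matrix.diagonal_apply]
    by_cases h : l = l'
    · subst h; simp
    · have h' : ¬ ((fun _ => false) = l ∧ (fun _ => false) = l') :=
        fun hm => h (hm.1.symm.trans hm.2)
      simp [h, h']
  rw [hdiag, Matrix.rank_diagonal] at hrank
  have hne : ∀ l : K → Bool, ((d : ℂ) ^ Fintype.card V)⁻¹ *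
      ((if (fun _ => false) = l then 1 else 0) + (ε : ℂ)) ≠ 0 := by
    intro l
    refine mul_ne_zero (inv_ne_zero hN) ?_
    split_ifs
    · have : (1 + ε : ℝ) ≠ 0 := by positivity
      exact_mod_cast this
    · rw [zero_add]
      exact_mod_cast hε.ne'
  rw [Fintype.card_congr (Equiv.subtypeUnivEquiv hne)] at hrank
  simpa using hrank

end VolumeLaw

/-! ### Cutting the lattice into two halves -/

section Main

-- A cut edge changes coordinate 0, either from `h - 1` to `h` or across the periodic boundary, and
-- fixes the other `k` coordinates. With open boundary conditions the second family contains no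
-- edges, which does not harm an upper bound.
open Classical in
theorem card_cutEdge_le (bc : Boundary) {k M h : ℕ} (h0 : 0 < h) (hM : h < M) :
    Fintype.card (CutEdge (lattice bc (k + 1) M)
      ({v | (v 0).val < h} : Finset (Site (k + 1) M))) ≤ 2 * M ^ k := by
  let f : Bool × (Fin k → Fin M) → Sym2 (Site (k + 1) M) := fun x =>
    s(Fin.cons (if x.1 then ⟨h - 1, by omega⟩ else ⟨0, by omega⟩) x.2,
      Fin.cons (if x.1 then ⟨h, hM⟩ else ⟨M - 1, by omega⟩) x.2)
  have hadj : ∀ v w : Site (k + 1) M, (lattice bc (k + 1) M).Adj v w → (v 0).val < h →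
      ¬ (w 0).val < h → ∃ x, f x = s(v, w) := by
    rintro v w ⟨i, hi, hi'⟩ hv hw
    have hi0 : i = 0 := by
      by_contra hne
      rw [hi' 0 (Ne.symm hne)] at hv
      exact hw hv
    subst hi0
    have htail : (fun j : Fin k => w j.succ) = fun j => v j.succ :=
      funext fun j => (hi' _ (Fin.succ_ne_zero j)).symm
    have hcons : ∀ (u : Site (k + 1) M) (a : Fin M), a = u 0 →
        (Fin.cons a fun j => u j.succ) = u := by
      rintro u _ rfl
      exact Fin.cons_self_tail u
    have hl := line_adj hi
    by_cases hb : (v 0).val + 1 = (w 0).val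
    · refine ⟨(true, fun j => v j.succ), ?_⟩
      simp only [f, if_true]
      rw [hcons v _ (Fin.ext (by simp only; omega)), ← htail,
        hcons w _ (Fin.ext (by simp only; omega))]
    · refine ⟨(false, fun j => v j.succ), ?_⟩
      have := (w 0).isLt
      simp only [f, Bool.false_eq_true, if_false]
      rw [hcons v _ (Fin.ext (by simp only; omega)), ← htail,
        hcons w _ (Fin.ext (by simp only; omega))]
  have hex : ∀ e : CutEdge (lattice bc (k + 1) M)
      ({v | (v 0).val < h} : Finset (Site (k + 1) M)), ∃ x, f x = e.1.1 := by
    rintro ⟨⟨e, he⟩, ⟨v, hv, hvL⟩, ⟨w, hw, hwL⟩⟩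
    simp only [Finset.mem_filter, Finset.mem_univ, true_and] at hvL hwL
    have hvw : v ≠ w := fun h => hwL (h ▸ hvL)
    obtain rfl := (Sym2.mem_and_mem_iff hvw).1 ⟨hv, hw⟩
    exact hadj v w he hvL hwL
  choose g hg using hex
  have hinj : Function.Injective g := fun e e' h =>
    Subtype.ext (Subtype.ext (by rw [← hg, ← hg, h]))
  refine (Fintype.card_le_of_injective g hinj).trans ?_
  simp

/-- Each site of one half is paired with its translate by `M / 2` along coordinate 0. The `M / 2 * M
^ k` shared labels face at most `2 * M ^ k` cut edges, so the factor `M ^ k` cancels and `2 ^ (M /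
2) ≤ D ^ 2`. -/
theorem exists_LPQC_volumeLaw (bc : Boundary) {dL d M : ℕ} (hdL : 1 ≤ dL) (hd : 2 ≤ d)
    (hM : 4 ≤ M) : ∃ E ∈ LPQC (lattice bc dL M) d,
      ∀ D : ℕ, IsPEPO (lattice bc dL M) D (choi E) → 2 ^ M ≤ D ^ 8 := by
  classical
  obtain ⟨k, rfl⟩ : ∃ k, dL = k + 1 := ⟨dL - 1, by omega⟩
  have hh : 0 < M / 2 := by omega
  have hhM : M / 2 < M := by omega
  have : Nonempty (Site (k + 1) M) := ⟨fun _ => ⟨0, by omega⟩⟩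
  let π : Site (k + 1) M → Fin (M / 2) × (Fin k → Fin M) := fun v =>
    (⟨(v 0).val % (M / 2), Nat.mod_lt _ hh⟩, fun i => v i.succ)
  let L : Finset (Site (k + 1) M) := {v | (v 0).val < M / 2}
  obtain ⟨E, hE, hPEPO⟩ := exists_fQC_volumeLaw (lattice_preconnected bc (k + 1) M) hd π L
    (by
      rintro ⟨a, r⟩
      refine ⟨Fin.cons ⟨a, by omega⟩ r, by simp [L], ?_⟩
      simp [π, Nat.mod_eq_of_lt a.isLt])
    (by
      rintro ⟨a, r⟩
      refine ⟨Fin.cons ⟨a + M / 2, by omega⟩ r, by simp [L], ?_⟩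
      simp [π, Nat.mod_eq_of_lt a.isLt])
  refine ⟨E, fQC_subset_LPQC _ (by omega) hE, fun D hD => ?_⟩
  have h1 := hPEPO D hD
  have h2 := card_cutEdge_le bc (k := k) hh hhM
  simp only [Fintype.card_prod, Fintype.card_fun, Fintype.card_fin] at h1
  have hMk : 0 < M ^ k := Nat.pow_pos (by omega)
  have hD0 : 0 < D := by
    rcases Nat.eq_zero_or_pos D with rfl | h
    · have h3 : 1 < 2 ^ (M / 2 * M ^ k) := Nat.one_lt_two_pow (Nat.mul_pos hh hMk).ne'
      have h4 := Nat.pow_le_pow_left zero_le_one (Fintype.card (CutEdge (lattice bc (k + 1) M) L))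
      rw [one_pow] at h4
      exact absurd (h3.trans_le (h1.trans h4)) (lt_irrefl _)
    · exact h
  have h3 := h1.trans (Nat.pow_le_pow_right hD0 h2)
  rw [pow_mul, pow_mul, Nat.pow_le_pow_iff_left hMk.ne'] at h3
  -- The exponent is doubled once more than for even `M`, to absorb the rounding of `M / 2`.
  calc 2 ^ M ≤ 2 ^ (M / 2 * 4) := Nat.pow_le_pow_right (by norm_num) (by omega)
    _ = (2 ^ (M / 2)) ^ 4 := pow_mul _ _ _
    _ ≤ (D ^ 2) ^ 4 := Nat.pow_le_pow_left h3 4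
    _ = D ^ 8 := by rw [← pow_mul]

end Main

end QuditLattice

theorem theorem2 :
    -- inclusions among the classes that do not refer to tensor networks, on every single lattice
    (∀ (bc : Boundary) (dL M d : ℕ), 1 ≤ dL → 4 ≤ M → 2 ≤ d →
      dQC (lattice bc dL M) d ⊂ fQC (lattice bc dL M) d ∧
      fQC (lattice bc dL M) d = LPQC (lattice bc dL M) d ∧
      LPQC (lattice bc dL M) d ⊆ CPQC (lattice bc dL M) d ∧
      (¬ (bc = Boundary.periodic ∧ dL = 1 ∧ M ≤ 5) →
        LPQC (lattice bc dL M) d ⊂ CPQC (lattice bc dL M) d)) ∧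
    -- every large enough bound on the bond dimension, as a function of `d`, `dL` and `z = 2 dL`
    (∃ f₀ : ℕ → ℕ → ℕ → ℕ, ∀ f : ℕ → ℕ → ℕ → ℕ, f₀ ≤ f →
      ∀ (bc : Boundary) (dL M d : ℕ), 1 ≤ dL → 4 ≤ M → 2 ≤ d →
        dQC (lattice bc dL M) d ⊂ tnQC (lattice bc dL M) d (f d dL (2 * dL)) ∧
        (¬ (bc = Boundary.periodic ∧ dL = 1 ∧ M ≤ 5) →
          ¬ tnQC (lattice bc dL M) d (f d dL (2 * dL)) ⊆ LPQC (lattice bc dL M) d)) ∧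
    -- no bound on the bond dimension that is independent of `M` holds on all of LPQC
    (∀ (f : ℕ → ℕ → ℕ → ℕ) (bc : Boundary) (dL d : ℕ), 1 ≤ dL → 2 ≤ d →
      ∃ M₀ : ℕ, ∀ M, M₀ ≤ M →
        ¬ LPQC (lattice bc dL M) d ⊆ tnQC (lattice bc dL M) d (f d dL (2 * dL))) ∧
    -- locality preserving channels whose bond dimension grows exponentially with `M`
    (∀ (bc : Boundary) (dL d : ℕ), 1 ≤ dL → 2 ≤ d →
      ∃ c : ℝ, 1 < c ∧ ∀ M, 4 ≤ M → ∃ E ∈ LPQC (lattice bc dL M) d,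
        ∀ D : ℕ, IsPEPO (lattice bc dL M) D (choi E) → c ^ M ≤ (D : ℝ)) := by
  have hmixed : ∀ (bc : Boundary) (dL M d : ℕ), 4 ≤ M → 2 ≤ d →
      prep (maxMixed (Site dL M) d) ∈ fQC (lattice bc dL M) d ∧
      prep (maxMixed (Site dL M) d) ∉ dQC (lattice bc dL M) d := by
    intro bc dL M d hM hd
    have : NeZero d := ⟨by omega⟩
    have : Nonempty (Site dL M) := ⟨fun _ => ⟨0, by omega⟩⟩
    exact ⟨prep_maxMixed_mem_fQC _, prep_maxMixed_notMem_dQC hd _⟩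
  have htwo : ∀ (bc : Boundary) (dL M d : ℕ), 1 ≤ dL → 4 ≤ M → 2 ≤ d →
      ¬ (bc = Boundary.periodic ∧ dL = 1 ∧ M ≤ 5) →
      ∃ E ∈ tnQC (lattice bc dL M) d 2, E ∉ LPQC (lattice bc dL M) d := by
    intro bc dL M d hdL hM hd hne
    obtain ⟨n, m, hnm⟩ := exists_far_sites hdL hM hne
    have : Nonempty (Site dL M) := ⟨n⟩
    have hxy : (⟨0, by omega⟩ : Fin d) ≠ ⟨1, by omega⟩ := by simp
    refine ⟨prep (twoPhase _ ⟨0, by omega⟩ ⟨1, by omega⟩),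
      ⟨prep_mem_CPQC (posSemidef_twoPhase _ _) (trace_twoPhase _ _) _, 2, le_rfl,
        isPEPO_twoPhase (lattice_preconnected bc dL M) hxy⟩, ?_⟩
    rw [← fQC_eq_LPQC _ (by omega)]
    exact prep_twoPhase_notMem_fQC hxy hnm
  -- The bound `d ^ 4` is the one for dilations; it also exceeds the bond dimensions 1 and 2 of the
  -- separating examples.
  refine ⟨fun bc dL M d hdL hM hd => ?_, ⟨fun d _ _ => d ^ 4, fun f hf bc dL M d hdL hM hd => ?_⟩,
    fun f bc dL d hdL hd => ?_, fun bc dL d hdL hd => ?_⟩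
  · have hd0 : d ≠ 0 := by omega
    have : NeZero d := ⟨hd0⟩
    obtain ⟨h1, h2⟩ := hmixed bc dL M d hM hd
    have hsub : LPQC (lattice bc dL M) d ⊆ CPQC (lattice bc dL M) d :=
      fun E hE => (LPQC_subset_fQC _ hd0 hE).1
    refine ⟨⟨dQC_subset_fQC _, fun h => h2 (h h1)⟩, fQC_eq_LPQC _ hd0, hsub,
      fun hne => ⟨hsub, fun h => ?_⟩⟩
    obtain ⟨E, hE, hE'⟩ := htwo bc dL M d hdL hM hd hne
    exact hE' (h hE.1)
  · have : NeZero d := ⟨by omega⟩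
    obtain ⟨h1, h2⟩ := hmixed bc dL M d hM hd
    have hfd : d ^ 4 ≤ f d dL (2 * dL) := hf d dL (2 * dL)
    have h2f : 2 ≤ f d dL (2 * dL) := by
      have : d ^ 1 ≤ d ^ 4 := Nat.pow_le_pow_right (by omega) (by norm_num)
      rw [pow_one] at this
      omega
    refine ⟨⟨dQC_subset_tnQC (qudits_singleton_mem_regS bc hdL hM) hfd, fun h => h2 (h ?_)⟩,
      fun hne h => ?_⟩
    · exact ⟨h1.1, 1, by omega, isPEPO_maxMixed _⟩
    · obtain ⟨E, ⟨hE, D, hD, hEP⟩, hE'⟩ := htwo bc dL M d hdL hM hd hne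
      exact hE' (h ⟨hE, D, hD.trans h2f, hEP⟩)
  -- For such `M` a bounded bond dimension would give `2 ^ M ≤ f ^ 8 ≤ M`.
  · refine ⟨max 4 (f d dL (2 * dL) ^ 8), fun M hM h => ?_⟩
    obtain ⟨E, hE, hPEPO⟩ := exists_LPQC_volumeLaw bc hdL hd ((le_max_left _ _).trans hM)
    obtain ⟨_, D, hD, hEP⟩ := h hE
    have h1 := (hPEPO D hEP).trans (Nat.pow_le_pow_left hD 8)
    exact absurd (M.lt_two_pow_self.trans_le (h1.trans ((le_max_right _ _).trans hM)))
      (lt_irrefl _)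
  -- The growth constant is the eighth root of 2, from `2 ^ M ≤ D ^ 8`.
  · have hc : ((2 : ℝ) ^ (1 / 8 : ℝ)) ^ 8 = 2 := by
      rw [← Real.rpow_natCast, ← Real.rpow_mul zero_le_two]
      norm_num
    refine ⟨2 ^ (1 / 8 : ℝ), Real.one_lt_rpow one_lt_two (by norm_num), fun M hM => ?_⟩
    obtain ⟨E, hE, hPEPO⟩ := exists_LPQC_volumeLaw bc hdL hd hM
    refine ⟨E, hE, fun D hD => ?_⟩
    refine le_of_pow_le_pow_left₀ (n := 8) (by norm_num) (Nat.cast_nonneg _) ?_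
    rw [← pow_mul, mul_comm, pow_mul, hc]
    exact_mod_cast hPEPO D hD
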